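/- Let $N\ge 1$, let $t_0=e^{-\tau_0}>0$, and consider a vacuum (i.e. Ricci-flat) Gowdy spacetime of dimension $N+2$ with a free $T^N$-action, possibly twisted globally around the circle, over the base $(0,t_0]\times Y$, $Y=S^1=\mathbb R/\mathbb Z$. That is, on the universal cover $(0,t_0]\times\mathbb R$ of the base, with coordinates $(t,y)$, the metric is $$\overline g=\sum_{I,J=1}^N G_{IJ}(t,y)\,dx^I dx^J-L(t,y)^2\,dt^2+h(t,y)\,dy^2 ,$$ where $L,h>0$ are smooth functions on $(0,t_0]\times\mathbb R$, $1$-periodic in $y$, and $G=(G_{IJ})$ is a smooth positive definite symmetric matrix function with $G(t,y+1)=\mathcal T^{T}G(t,y)\,\mathcal T$ for a fixed $\mathcal T\in \mathrm{SL}(N,\mathbb R)$ (so $G$ is an inner product on the flat $\mathbb R^N$-bundle $e$ over the circle with holonomy $\mathcal T$; $\mathcal T=I$ in the untwisted case). Assume that the time function is areal, $\det G=t^N$. Put $t=e^{-\tau}$, and let $$\mu=L^{-1}\sqrt{\det G}\;(\partial_t\ln\det G)\,\sqrt h\,dy=m\,dy ,$$ a density on $Y$. A time-$\tau$ self-adjoint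 section is an endomorphism field $\sigma$ of $e$ (a matrix function with $\sigma(y+1)=\mathcal T^{-1}\sigma(y)\mathcal T$) such that $\sigma^T=G\sigma G^{-1}$, where $G=G(e^{-\tau},\cdot)$; put $D_y\sigma=\sigma_y+\frac12[G^{-1}G_y,\sigma]$ and $$\|\eta\|_{H^{-1}_\tau}=\sup_{\widehat\eta\ne0}\ \frac{\int_Y \operatorname{Tr}(\eta\widehat\eta)\,d\mu}{\sqrt{\int_Y\left(\operatorname{Tr}(\widehat\eta^{\,2})\,m+\operatorname{Tr}\big((D_y\widehat\eta)^2\big)\,m^{-1}\right)dy}}\ ,$$ where $\widehat\eta$ ranges over the nonzero smooth time-$\tau$ self-adjoint sections and all of $\mu$, $G$, $D_y$ are taken at time $t=e^{-\tau}$. Then $\tau\mapsto\|(G^{-1}G_\tau)_\tau\|_{H^{-1}_\tau}$ is (Lebesgue) measurable on $[\tau_0,\infty)$ and $$\int_{\tau_0}^\infty e^{N\tau}\,\big\|(G^{-1}G_\tau)_\tau\big\|^2_{H^{-1}_\tau}\,d\tau<\infty .$$ -/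

import Mathlib

open scoped ContDiff

noncomputable section

/-! ### Curvature of a (pseudo-)Riemannian metric in coordinates -/

/-- The partial derivative `∂f/∂xⁱ` at `x`. -/
def pd {ι : Type} [DecidableEq ι] (i : ι) (f : (ι → ℝ) → ℝ) (x : ι → ℝ) : ℝ :=
  deriv (fun s => f (Function.update x i s)) (x i)

/-- The Christoffel symbols
`Γᵏᵢⱼ = ½ gᵏˡ (∂ᵢ gⱼₗ + ∂ⱼ gᵢₗ - ∂ₗ gᵢⱼ)` of a metric `g`. -/
def christoffel {ι : Type} [Fintype ι] [DecidableEq ι] (g : (ι → ℝ) → Matrix ι ι ℝ)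
    (k i j : ι) (x : ι → ℝ) : ℝ :=
  (1 / 2 : ℝ) * ∑ l, (g x)⁻¹ k l *
    (pd i (fun z => g z j l) x + pd j (fun z => g z i l) x - pd l (fun z => g z i j) x)

/-- The Ricci tensor
`Rᵢⱼ = ∂ₖ Γᵏᵢⱼ - ∂ⱼ Γᵏᵢₖ + Γᵏₖₗ Γˡᵢⱼ - Γᵏⱼₗ Γˡᵢₖ` of a metric `g`. -/
def ricci {ι : Type} [Fintype ι] [DecidableEq ι] (g : (ι → ℝ) → Matrix ι ι ℝ)
    (i j : ι) (x : ι → ℝ) : ℝ :=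
  ∑ k, (pd k (christoffel g k i j) x - pd j (christoffel g k i k) x
    + ∑ l, (christoffel g k k l x * christoffel g l i j x
      - christoffel g k j l x * christoffel g l i k x))

/-! ### Gowdy spacetimes -/

/-- The entrywise derivative of a curve of matrices. -/
def matDeriv {N : ℕ} (A : ℝ → Matrix (Fin N) (Fin N) ℝ) (s : ℝ) : Matrix (Fin N) (Fin N) ℝ :=
  Matrix.of fun i j => deriv (fun r => A r i j) s

/-- A Gowdy metric `∑ G_IJ dxᴵ dxᴶ - L² dt² + h dy²` over the base `(0, t₀] × S¹`,
`S¹ = ℝ / ℤ`. The data are given on the universal cover `(0, t₀] × ℝ` of the base, with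
coordinates `(t, y)`. The lapse `L` and the spatial metric coefficient `h` are functions on
`(0, t₀] × S¹`, and `G` is a Euclidean inner product on the flat `ℝᴺ`-bundle `e` over
`(0, t₀] × S¹` whose holonomy around the circle is `hol` (the case `hol = 1` is that of an
untwisted torus action). The data are smooth up to and including `t = t₀`. -/
structure GowdySpacetime (N : ℕ) (t₀ : ℝ) where
  /-- the fibre metric -/
  G : ℝ → ℝ → Matrix (Fin N) (Fin N) ℝ
  /-- the lapse function -/
  L : ℝ → ℝ → ℝ
  /-- the coefficient of `dy²` in the metric of the slices `Y = S¹` of the base -/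
  h : ℝ → ℝ → ℝ
  /-- the holonomy of the flat bundle `e` around the circle -/
  hol : Matrix.SpecialLinearGroup (Fin N) ℝ
  smooth_G : ∀ i j, ContDiffOn ℝ ∞ (fun p : ℝ × ℝ => G p.1 p.2 i j)
    (Set.Ioc 0 t₀ ×ˢ Set.univ)
  smooth_L : ContDiffOn ℝ ∞ (fun p : ℝ × ℝ => L p.1 p.2) (Set.Ioc 0 t₀ ×ˢ Set.univ)
  smooth_h : ContDiffOn ℝ ∞ (fun p : ℝ × ℝ => h p.1 p.2) (Set.Ioc 0 t₀ ×ˢ Set.univ)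
  posDef_G : ∀ t ∈ Set.Ioc 0 t₀, ∀ y, (G t y).PosDef
  pos_L : ∀ t ∈ Set.Ioc 0 t₀, ∀ y, 0 < L t y
  pos_h : ∀ t ∈ Set.Ioc 0 t₀, ∀ y, 0 < h t y
  equivariant_G : ∀ t ∈ Set.Ioc 0 t₀, ∀ y,
    G t (y + 1) = (hol : Matrix (Fin N) (Fin N) ℝ).transpose * G t y
      * (hol : Matrix (Fin N) (Fin N) ℝ)
  periodic_L : ∀ t ∈ Set.Ioc 0 t₀, ∀ y, L t (y + 1) = L t y
  periodic_h : ∀ t ∈ Set.Ioc 0 t₀, ∀ y, h t (y + 1) = h t y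

namespace GowdySpacetime

variable {N : ℕ} {t₀ : ℝ} (S : GowdySpacetime N t₀)

/-- The spacetime metric `∑ G_IJ dxᴵ dxᴶ - L² dt² + h dy²` in the coordinates
`(x¹, …, xᴺ, t, y)`; here `t = z (inr 0)` and `y = z (inr 1)`. -/
def metric (z : Fin N ⊕ Fin 2 → ℝ) : Matrix (Fin N ⊕ Fin 2) (Fin N ⊕ Fin 2) ℝ :=
  Matrix.fromBlocks (S.G (z (Sum.inr 0)) (z (Sum.inr 1))) 0 0
    (Matrix.diagonal ![-(S.L (z (Sum.inr 0)) (z (Sum.inr 1))) ^ 2,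
      S.h (z (Sum.inr 0)) (z (Sum.inr 1))])

/-- The vacuum Einstein equation: the spacetime metric is Ricci flat. -/
def IsVacuum : Prop :=
  ∀ z : Fin N ⊕ Fin 2 → ℝ, z (Sum.inr 0) ∈ Set.Ioo 0 t₀ → ∀ i j, ricci S.metric i j z = 0

/-- The time coordinate is areal: `det G = tᴺ`. -/
def IsAreal : Prop :=
  ∀ t ∈ Set.Ioc 0 t₀, ∀ y, (S.G t y).det = t ^ N

/-- The coefficient of `dy` in the density
`μ = L⁻¹ √(det G) (∂ₜ ln det G) √h dy` on the circle, computed at time `t`. -/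
def mu (t y : ℝ) : ℝ :=
  (S.L t y)⁻¹ * √(S.G t y).det * deriv (fun s => Real.log (S.G s y).det) t * √(S.h t y)

/-- `η` is a smooth section, over the circle, of the bundle of those endomorphisms of `e` that
are self-adjoint at time `t`, that is `ηᵀ = G η G⁻¹`. -/
def IsSelfAdjointSection (t : ℝ) (η : ℝ → Matrix (Fin N) (Fin N) ℝ) : Prop :=
  (∀ i j, ContDiff ℝ ∞ (fun y => η y i j)) ∧
  (∀ y, η (y + 1) = ((S.hol⁻¹ : Matrix.SpecialLinearGroup (Fin N) ℝ) : Matrix (Fin N) (Fin N) ℝ)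
    * η y * (S.hol : Matrix (Fin N) (Fin N) ℝ)) ∧
  ∀ y, (η y).transpose = S.G t y * η y * (S.G t y)⁻¹

/-- `D_y η = η_y + ½ [G⁻¹ G_y, η]` at time `t`. -/
def Dy (t : ℝ) (η : ℝ → Matrix (Fin N) (Fin N) ℝ) (y : ℝ) : Matrix (Fin N) (Fin N) ℝ :=
  matDeriv η y + (1 / 2 : ℝ) •
    ((S.G t y)⁻¹ * matDeriv (S.G t) y * η y - η y * ((S.G t y)⁻¹ * matDeriv (S.G t) y))

/-- The square of the time-`t` Sobolev `H¹`-norm,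
`∫ (Tr (η²) dμ + Tr (D_Y η ⊗ D_Y η) / μ)`. -/
def sobolevSq (t : ℝ) (η : ℝ → Matrix (Fin N) (Fin N) ℝ) : ℝ :=
  ∫ y in (0 : ℝ)..1,
    (Matrix.trace (η y * η y) * S.mu t y + Matrix.trace (S.Dy t η y * S.Dy t η y) / S.mu t y)

/-- The time-`t` norm `‖η‖_{H⁻¹}`: the supremum of
`(∫ Tr (η ζ) dμ) / (∫ (Tr (ζ²) dμ + Tr (D_Y ζ ⊗ D_Y ζ) / μ))^{1/2}`
over the nonzero smooth self-adjoint sections `ζ`, with values in `[0, ∞]`. -/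
def hNegOneNorm (t : ℝ) (η : ℝ → Matrix (Fin N) (Fin N) ℝ) : ENNReal :=
  ⨆ (ζ : ℝ → Matrix (Fin N) (Fin N) ℝ) (_ : S.IsSelfAdjointSection t ζ) (_ : ζ ≠ 0),
    ENNReal.ofReal
      ((∫ y in (0 : ℝ)..1, Matrix.trace (η y * ζ y) * S.mu t y) / √(S.sobolevSq t ζ))

/-- `G⁻¹ G_τ` in the time variable `τ`, where `t = e^{-τ}`. -/
def velocity (τ y : ℝ) : Matrix (Fin N) (Fin N) ℝ :=
  (S.G (Real.exp (-τ)) y)⁻¹ * matDeriv (fun s => S.G (Real.exp (-s)) y) τ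

/-- `(G⁻¹ G_τ)_τ`. -/
def acceleration (τ y : ℝ) : Matrix (Fin N) (Fin N) ℝ :=
  matDeriv (fun s => S.velocity s y) τ

end GowdySpacetime

end

/-!
# Integrability of the acceleration of an areal vacuum Gowdy metric

Write `t = e^{-τ}`, `V = G⁻¹ G_τ` and `W = G⁻¹ G_y`. Only the components of the Ricci tensor along
the torus fibres matter. With `det G = tᴺ` they are the divergence-form equation
`∂ₜ (L⁻¹ √tᴺ √h G⁻¹ G_t) = ∂_y (L √tᴺ (√h)⁻¹ G⁻¹ G_y)` (`GowdySpacetime.wave_equation`). Its trace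
says that the density `μ = m dy` does not depend on time (`GowdySpacetime.mu_eq_mu`), and in terms
of `m` the equation becomes `V_τ = N² e^{-Nτ} m⁻¹ (m⁻¹ W)_y`
(`GowdySpacetime.hasMatDerivAt_velocity_and_spatialVelocity`).

Pairing with a test section `ζ` and integrating by parts over the circle replaces `ζ_y` by `D_y ζ`,
since the commutator in `D_y` is trace orthogonal to `W`. By the Cauchy-Schwarz inequality,
`‖V_τ‖_{H⁻¹} ≤ N² e^{-Nτ} (∫ Tr (W²) / m)^{1/2}`
(`GowdySpacetime.hNegOneNorm_acceleration_le`), and so `e^{Nτ} ‖V_τ‖²` is at most `N²` times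
`N² e^{-Nτ} ∫ Tr (W²) / m`.

This last function is integrable because it is the dissipation of an energy: the energy
`½ ∫ (Tr (V²) m + N² e^{-Nτ} Tr (W²) / m) dy` changes only through the decay of the factor
`e^{-Nτ}`, that is, its `τ`-derivative is `-(N / 2) N² e^{-Nτ} ∫ Tr (W²) / m`
(`GowdySpacetime.deriv_energyDensity_sub_deriv_energyFlux`,
`GowdySpacetime.integral_dissipation_le`). Near `τ = τ₀` integrability is clear, since `W` involves
no time derivative and is smooth up to `t = t₀`.

The norm is measurable in `τ` because it is lower semicontinuous on `(τ₀, ∞)`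
(`GowdySpacetime.eventually_lt_hNegOneNorm`): a test section at one time extends to a smooth family
of test sections at all times by keeping the bilinear form `G ζ` fixed, and the quotients in the
definition of the norm are continuous along such a family.
-/

noncomputable section

/-! ### Derivatives of curves of matrices -/

/-- `A'` is the entrywise derivative of the curve of matrices `A` at `s`. -/
def HasMatDerivAt {N : ℕ} (A : ℝ → Matrix (Fin N) (Fin N) ℝ) (A' : Matrix (Fin N) (Fin N) ℝ)
    (s : ℝ) : Prop :=
  ∀ i j, HasDerivAt (fun r => A r i j) (A' i j) s

namespace HasMatDerivAt

variable {N : ℕ} {A B : ℝ → Matrix (Fin N) (Fin N) ℝ} {A' B' : Matrix (Fin N) (Fin N) ℝ} {s : ℝ}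

theorem matDeriv_eq (h : HasMatDerivAt A A' s) : matDeriv A s = A' := by
  ext i j; exact (h i j).deriv

theorem congr_of_eventuallyEq (h : HasMatDerivAt A A' s) (hAB : B =ᶠ[nhds s] A) :
    HasMatDerivAt B A' s := fun i j =>
  (h i j).congr_of_eventuallyEq (hAB.mono fun r hr => by simp only [hr])

theorem mul (hA : HasMatDerivAt A A' s) (hB : HasMatDerivAt B B' s) :
    HasMatDerivAt (fun r => A r * B r) (A' * B s + A s * B') s := fun i j => by
  simp only [Matrix.mul_apply, Matrix.add_apply, ← Finset.sum_add_distrib]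
  exact HasDerivAt.fun_sum fun k _ => (hA i k).fun_mul (hB k j)

theorem smul {c : ℝ → ℝ} {c' : ℝ} (hc : HasDerivAt c c' s) (hA : HasMatDerivAt A A' s) :
    HasMatDerivAt (fun r => c r • A r) (c' • A s + c s • A') s := fun i j =>
  hc.fun_mul (hA i j)

theorem const (M : Matrix (Fin N) (Fin N) ℝ) (s : ℝ) : HasMatDerivAt (fun _ => M) 0 s :=
  fun i j => hasDerivAt_const s (M i j)

theorem transpose (hA : HasMatDerivAt A A' s) :
    HasMatDerivAt (fun r => (A r).transpose) A'.transpose s := fun i j => hA j i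

theorem trace (hA : HasMatDerivAt A A' s) :
    HasDerivAt (fun r => (A r).trace) A'.trace s :=
  HasDerivAt.fun_sum fun i _ => hA i i

theorem comp {u : ℝ → ℝ} {u' : ℝ} (hA : HasMatDerivAt A A' (u s)) (hu : HasDerivAt u u' s) :
    HasMatDerivAt (fun r => A (u r)) (u' • A') s := fun i j => by
  have := (hA i j).comp s hu
  rw [mul_comm] at this
  exact this

theorem comp_add_const {c : ℝ} (hA : HasMatDerivAt A A' (s + c)) :
    HasMatDerivAt (fun r => A (r + c)) A' s := fun i j => (hA i j).comp_add_const s c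

/-- Jacobi's formula for the derivative of a determinant. -/
theorem det (hA : HasMatDerivAt A A' s) :
    HasDerivAt (fun r => (A r).det) ((A s).adjugate * A').trace s := by
  have h1 : HasDerivAt (fun r => (A r).det)
      (∑ σ : Equiv.Perm (Fin N), ((Equiv.Perm.sign σ : ℤ) : ℝ) *
        ∑ i, (∏ j ∈ Finset.univ.erase i, A s (σ j) j) • A' (σ i) i) s := by
    simp only [Matrix.det_apply']
    exact HasDerivAt.fun_sum fun σ _ =>
      (HasDerivAt.fun_finsetProd fun i _ => hA (σ i) i).const_mul _
  convert h1 using 1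
  have h2 : ∀ i, ((A s).adjugate * A') i i =
      ∑ σ : Equiv.Perm (Fin N), ((Equiv.Perm.sign σ : ℤ) : ℝ) *
        ((∏ j ∈ Finset.univ.erase i, A s (σ j) j) * A' (σ i) i) := by
    intro i
    have h3 : ((A s).adjugate * A') i i = ((A s).adjugate.mulVec (fun k => A' k i)) i := rfl
    rw [h3, ← Matrix.cramer_eq_adjugate_mulVec, Matrix.cramer_apply, Matrix.det_apply']
    refine Finset.sum_congr rfl fun σ _ => ?_
    rw [← Finset.prod_erase_mul _ _ (Finset.mem_univ i)]
    congr 2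
    · refine Finset.prod_congr rfl fun j hj => ?_
      rw [Matrix.updateCol_ne (Finset.ne_of_mem_erase hj)]
    · rw [Matrix.updateCol_self]
  simp only [Matrix.trace, Matrix.diag_apply, h2, smul_eq_mul, Finset.mul_sum]
  exact Finset.sum_comm

theorem inv (hA : HasMatDerivAt A A' s) (hdet : (A s).det ≠ 0) :
    HasMatDerivAt (fun r => (A r)⁻¹) (-((A s)⁻¹ * A' * (A s)⁻¹)) s := by
  -- differentiability of the inverse comes from the adjugate formula
  have hdiff : ∀ i j, ∃ b, HasDerivAt (fun r => (A r)⁻¹ i j) b s := by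
    intro i j
    have hadj : ∃ b, HasDerivAt (fun r => (A r).adjugate i j) b s := by
      have : HasMatDerivAt (fun r => (A r).updateRow j (Pi.single i 1))
          (A'.updateRow j 0) s := by
        intro k l
        by_cases hk : k = j
        · subst hk
          simpa using hasDerivAt_const s ((Pi.single i 1 : Fin N → ℝ) l)
        · simpa [Matrix.updateRow_ne hk] using hA k l
      exact ⟨_, by simpa only [Matrix.adjugate_apply] using this.det⟩
    obtain ⟨b, hb⟩ := hadj
    refine ⟨_, HasDerivAt.congr_of_eventuallyEq ((hA.det.fun_inv hdet).fun_mul hb) ?_⟩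
    exact Filter.Eventually.of_forall fun r => by simp [Matrix.inv_def]
  choose b hb using hdiff
  have hb' : HasMatDerivAt (fun r => (A r)⁻¹) (Matrix.of b) s := fun i j => hb i j
  -- its value comes from differentiating `A * A⁻¹ = 1`
  have h1 : HasMatDerivAt (fun r => A r * (A r)⁻¹) 0 s := by
    refine (HasMatDerivAt.const 1 s).congr_of_eventuallyEq ?_
    filter_upwards [hA.det.continuousAt.eventually_ne hdet] with r hr
    exact Matrix.mul_nonsing_inv _ (isUnit_iff_ne_zero.2 hr)
  have h2 := (hA.mul hb').matDeriv_eq.symm.trans h1.matDeriv_eq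
  have h3 : Matrix.of b = -((A s)⁻¹ * A' * (A s)⁻¹) := by
    have h4 := congrArg (fun M => (A s)⁻¹ * M) h2
    simp only [mul_add, mul_zero] at h4
    rw [← mul_assoc (A s)⁻¹ (A s), Matrix.nonsing_inv_mul _ (isUnit_iff_ne_zero.2 hdet), one_mul,
      ← mul_assoc] at h4
    exact eq_neg_of_add_eq_zero_right h4
  rw [← h3]
  exact hb'

end HasMatDerivAt

/-! ### Smooth functions on a strip -/

section Strip

variable {T : Set ℝ} {f : ℝ → ℝ → ℝ}

theorem hasDerivAt_snd_of_contDiffOn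
    (hf : ContDiffOn ℝ ∞ (fun p : ℝ × ℝ => f p.1 p.2) (T ×ˢ Set.univ)) {t : ℝ} (ht : t ∈ T)
    (y : ℝ) :
    HasDerivAt (f t) (fderivWithin ℝ (fun p : ℝ × ℝ => f p.1 p.2) (T ×ˢ Set.univ) (t, y) (0, 1))
      y := by
  have h1 : HasFDerivWithinAt (fun p : ℝ × ℝ => f p.1 p.2) _ (T ×ˢ Set.univ) (t, y) :=
    (hf.differentiableOn (by simp) (t, y) ⟨ht, trivial⟩).hasFDerivWithinAt
  have h2 : HasDerivAt (fun y : ℝ => (t, y)) ((0, 1) : ℝ × ℝ) y :=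
    (hasDerivAt_const y t).prodMk (hasDerivAt_id y)
  have h3 := HasFDerivWithinAt.comp_hasDerivWithinAt (s := Set.univ) y h1 h2.hasDerivWithinAt
    (fun z _ => ⟨ht, trivial⟩)
  exact h3.hasDerivAt Filter.univ_mem

theorem contDiffOn_deriv_snd (hT : UniqueDiffOn ℝ T)
    (hf : ContDiffOn ℝ ∞ (fun p : ℝ × ℝ => f p.1 p.2) (T ×ˢ Set.univ)) :
    ContDiffOn ℝ ∞ (fun p : ℝ × ℝ => deriv (f p.1) p.2) (T ×ˢ Set.univ) := by
  have h := (hf.fderivWithin (hT.prod uniqueDiffOn_univ) (m := ∞) (by simp)).clm_apply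
    (contDiffOn_const (c := ((0, 1) : ℝ × ℝ)))
  exact h.congr fun p hp => (hasDerivAt_snd_of_contDiffOn hf hp.1 p.2).deriv

theorem hasDerivAt_fst_of_contDiffOn (hT : IsOpen T)
    (hf : ContDiffOn ℝ ∞ (fun p : ℝ × ℝ => f p.1 p.2) (T ×ˢ Set.univ)) {t : ℝ} (ht : t ∈ T)
    (y : ℝ) :
    HasDerivAt (fun s => f s y) (fderiv ℝ (fun p : ℝ × ℝ => f p.1 p.2) (t, y) (1, 0)) t := by
  have h1 : HasFDerivAt (fun p : ℝ × ℝ => f p.1 p.2) _ (t, y) :=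
    ((hf.contDiffAt ((hT.prod isOpen_univ).mem_nhds ⟨ht, trivial⟩)).differentiableAt
      (by simp)).hasFDerivAt
  exact h1.comp_hasDerivAt t ((hasDerivAt_id t).prodMk (hasDerivAt_const t y))

theorem contDiffOn_deriv_fst (hT : IsOpen T)
    (hf : ContDiffOn ℝ ∞ (fun p : ℝ × ℝ => f p.1 p.2) (T ×ˢ Set.univ)) :
    ContDiffOn ℝ ∞ (fun p : ℝ × ℝ => deriv (fun s => f s p.2) p.1) (T ×ˢ Set.univ) := by
  have h := (hf.fderiv_of_isOpen (hT.prod isOpen_univ) (m := ∞) (by simp)).clm_apply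
    (contDiffOn_const (c := ((1, 0) : ℝ × ℝ)))
  exact h.congr fun p hp => (hasDerivAt_fst_of_contDiffOn hT hf hp.1 p.2).deriv

theorem deriv_deriv_comm (hT : IsOpen T)
    (hf : ContDiffOn ℝ ∞ (fun p : ℝ × ℝ => f p.1 p.2) (T ×ˢ Set.univ)) {t : ℝ} (ht : t ∈ T)
    (y : ℝ) :
    deriv (fun s => deriv (f s) y) t = deriv (fun z => deriv (fun s => f s z) t) y := by
  set F : ℝ × ℝ → ℝ := fun p => f p.1 p.2 with hF
  have hΩ : IsOpen (T ×ˢ (Set.univ : Set ℝ)) := hT.prod isOpen_univ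
  have hmem : T ×ˢ (Set.univ : Set ℝ) ∈ nhds (t, y) := hΩ.mem_nhds ⟨ht, trivial⟩
  have hF' : ContDiffOn ℝ ∞ (fderiv ℝ F) (T ×ˢ Set.univ) := hf.fderiv_of_isOpen hΩ (by simp)
  have hd : HasFDerivAt (fderiv ℝ F) (fderiv ℝ (fderiv ℝ F) (t, y)) (t, y) :=
    ((hF'.contDiffAt hmem).differentiableAt (by simp)).hasFDerivAt
  have hsymm : IsSymmSndFDerivAt ℝ F (t, y) :=
    (hf.contDiffAt hmem).isSymmSndFDerivAt (by
      rw [minSmoothness_of_isRCLikeNormedField]; exact WithTop.coe_le_coe.2 (le_top : (2 : ℕ∞) ≤ ⊤))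
  have h1 : deriv (fun s => deriv (f s) y) t = fderiv ℝ (fderiv ℝ F) (t, y) (1, 0) (0, 1) := by
    have e : (fun s => deriv (f s) y) =ᶠ[nhds t] fun s => fderiv ℝ F (s, y) (0, 1) := by
      filter_upwards [hT.mem_nhds ht] with s hs
      rw [(hasDerivAt_snd_of_contDiffOn hf hs y).deriv,
        fderivWithin_of_isOpen hΩ ⟨hs, trivial⟩]
    rw [e.deriv_eq]
    have h2 : HasDerivAt (fun s => fderiv ℝ F (s, y)) (fderiv ℝ (fderiv ℝ F) (t, y) (1, 0)) t :=
      hd.comp_hasDerivAt t ((hasDerivAt_id t).prodMk (hasDerivAt_const t y))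
    have h3 := h2.clm_apply (hasDerivAt_const t ((0, 1) : ℝ × ℝ))
    simpa using h3.deriv
  have h2 : deriv (fun z => deriv (fun s => f s z) t) y =
      fderiv ℝ (fderiv ℝ F) (t, y) (0, 1) (1, 0) := by
    have e : (fun z => deriv (fun s => f s z) t) = fun z => fderiv ℝ F (t, z) (1, 0) := by
      funext z
      exact (hasDerivAt_fst_of_contDiffOn hT hf ht z).deriv
    rw [e]
    have h2 : HasDerivAt (fun z => fderiv ℝ F (t, z)) (fderiv ℝ (fderiv ℝ F) (t, y) (0, 1)) y :=
      hd.comp_hasDerivAt y ((hasDerivAt_const y t).prodMk (hasDerivAt_id y))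
    have h3 := h2.clm_apply (hasDerivAt_const y ((1, 0) : ℝ × ℝ))
    simpa using h3.deriv
  rw [h1, h2]
  exact hsymm (1, 0) (0, 1)

end Strip

/-! ### Smooth matrix functions of two variables -/

/-- The matrix function `A` of two variables is smooth on `Ω`. -/
def MatContDiffOn {N : ℕ} (A : ℝ → ℝ → Matrix (Fin N) (Fin N) ℝ) (Ω : Set (ℝ × ℝ)) : Prop :=
  ∀ i j, ContDiffOn ℝ ∞ (fun p : ℝ × ℝ => A p.1 p.2 i j) Ω

namespace MatContDiffOn

variable {N : ℕ} {A B : ℝ → ℝ → Matrix (Fin N) (Fin N) ℝ} {Ω : Set (ℝ × ℝ)} {T : Set ℝ}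

theorem add (hA : MatContDiffOn A Ω) (hB : MatContDiffOn B Ω) :
    MatContDiffOn (fun t y => A t y + B t y) Ω := fun i j => (hA i j).add (hB i j)

theorem sub (hA : MatContDiffOn A Ω) (hB : MatContDiffOn B Ω) :
    MatContDiffOn (fun t y => A t y - B t y) Ω := fun i j => (hA i j).sub (hB i j)

theorem mul (hA : MatContDiffOn A Ω) (hB : MatContDiffOn B Ω) :
    MatContDiffOn (fun t y => A t y * B t y) Ω := fun i j => by
  simp only [Matrix.mul_apply]
  exact ContDiffOn.sum fun k _ => (hA i k).mul (hB k j)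

theorem smul {c : ℝ → ℝ → ℝ} (hc : ContDiffOn ℝ ∞ (fun p : ℝ × ℝ => c p.1 p.2) Ω)
    (hA : MatContDiffOn A Ω) : MatContDiffOn (fun t y => c t y • A t y) Ω := fun i j =>
  hc.mul (hA i j)

theorem trace (hA : MatContDiffOn A Ω) :
    ContDiffOn ℝ ∞ (fun p : ℝ × ℝ => (A p.1 p.2).trace) Ω :=
  ContDiffOn.sum fun i _ => hA i i

theorem det (hA : MatContDiffOn A Ω) :
    ContDiffOn ℝ ∞ (fun p : ℝ × ℝ => (A p.1 p.2).det) Ω := by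
  simp only [Matrix.det_apply']
  exact ContDiffOn.sum fun σ _ => contDiffOn_const.mul (contDiffOn_prod fun i _ => hA (σ i) i)

theorem inv (hA : MatContDiffOn A Ω) (hdet : ∀ p ∈ Ω, (A p.1 p.2).det ≠ 0) :
    MatContDiffOn (fun t y => (A t y)⁻¹) Ω := fun i j => by
  have hadj : ContDiffOn ℝ ∞ (fun p : ℝ × ℝ => (A p.1 p.2).adjugate i j) Ω := by
    have : MatContDiffOn (fun t y => (A t y).updateRow j (Pi.single i 1)) Ω := by
      intro k l
      by_cases hk : k = j
      · subst hk
        simpa using contDiffOn_const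
      · simpa [Matrix.updateRow_ne hk] using hA k l
    simpa only [Matrix.adjugate_apply] using this.det
  refine ((hA.det.inv hdet).mul hadj).congr fun p _ => ?_
  simp [Matrix.inv_def]

theorem mono {Ω' : Set (ℝ × ℝ)} (hA : MatContDiffOn A Ω) (h : Ω' ⊆ Ω) : MatContDiffOn A Ω' :=
  fun i j => (hA i j).mono h

theorem matDeriv_snd (hT : UniqueDiffOn ℝ T) (hA : MatContDiffOn A (T ×ˢ Set.univ)) :
    MatContDiffOn (fun t y => matDeriv (A t) y) (T ×ˢ Set.univ) := fun i j =>
  contDiffOn_deriv_snd (f := fun t y => A t y i j) hT (hA i j)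

theorem matDeriv_fst (hT : IsOpen T) (hA : MatContDiffOn A (T ×ˢ Set.univ)) :
    MatContDiffOn (fun t y => matDeriv (fun s => A s y) t) (T ×ˢ Set.univ) := fun i j =>
  contDiffOn_deriv_fst (f := fun t y => A t y i j) hT (hA i j)

theorem hasMatDerivAt_snd (hA : MatContDiffOn A (T ×ˢ Set.univ))
    {t : ℝ} (ht : t ∈ T) (y : ℝ) : HasMatDerivAt (A t) (matDeriv (A t) y) y := fun i j =>
  (hasDerivAt_snd_of_contDiffOn (f := fun t y => A t y i j)
    (hA i j) ht y).differentiableAt.hasDerivAt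

theorem hasMatDerivAt_fst (hT : IsOpen T) (hA : MatContDiffOn A (T ×ˢ Set.univ))
    {t : ℝ} (ht : t ∈ T) (y : ℝ) :
    HasMatDerivAt (fun s => A s y) (matDeriv (fun s => A s y) t) t := fun i j =>
  (hasDerivAt_fst_of_contDiffOn (f := fun t y => A t y i j) hT
    (hA i j) ht y).differentiableAt.hasDerivAt

/-- Mixed partial derivatives commute. -/
theorem matDeriv_comm (hT : IsOpen T) (hA : MatContDiffOn A (T ×ˢ Set.univ))
    {t : ℝ} (ht : t ∈ T) (y : ℝ) :
    matDeriv (fun s => matDeriv (A s) y) t = matDeriv (fun z => matDeriv (fun s => A s z) t) y := by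
  ext i j
  exact deriv_deriv_comm (f := fun t y => A t y i j) hT (hA i j) ht y

end MatContDiffOn

/-! ### The fibre components of the Ricci tensor -/

namespace GowdySpacetime

variable {N : ℕ} {t₀ : ℝ} (S : GowdySpacetime N t₀)

/-- The time derivative `G_t` of the fibre metric. -/
def dtG (t y : ℝ) : Matrix (Fin N) (Fin N) ℝ := matDeriv (fun s => S.G s y) t

/-- The space derivative `G_y` of the fibre metric. -/
def dyG (t y : ℝ) : Matrix (Fin N) (Fin N) ℝ := matDeriv (S.G t) y

section Ricci

variable (z : Fin N ⊕ Fin 2 → ℝ)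

theorem pd_metric_inl (k : Fin N) (i j : Fin N ⊕ Fin 2) :
    pd (Sum.inl k) (fun z => S.metric z i j) z = 0 := by
  simp [pd, metric]

theorem pd_metric_inl_inl_zero (I J : Fin N) :
    pd (Sum.inr 0) (fun z => S.metric z (Sum.inl I) (Sum.inl J)) z
      = S.dtG (z (Sum.inr 0)) (z (Sum.inr 1)) I J := by
  simp [pd, metric, dtG, matDeriv]

theorem pd_metric_inl_inl_one (I J : Fin N) :
    pd (Sum.inr 1) (fun z => S.metric z (Sum.inl I) (Sum.inl J)) z
      = S.dyG (z (Sum.inr 0)) (z (Sum.inr 1)) I J := by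
  simp [pd, metric, dyG, matDeriv]

theorem pd_metric_inl_inr (k : Fin N ⊕ Fin 2) (I : Fin N) (a : Fin 2) :
    pd k (fun z => S.metric z (Sum.inl I) (Sum.inr a)) z = 0 := by
  simp [pd, metric]

theorem pd_metric_inr_inl (k : Fin N ⊕ Fin 2) (I : Fin N) (a : Fin 2) :
    pd k (fun z => S.metric z (Sum.inr a) (Sum.inl I)) z = 0 := by
  simp [pd, metric]

theorem pd_metric_inr_inr_of_ne (k : Fin N ⊕ Fin 2) {a b : Fin 2} (hab : a ≠ b) :
    pd k (fun z => S.metric z (Sum.inr a) (Sum.inr b)) z = 0 := by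
  simp [pd, metric, Matrix.diagonal_apply_ne _ hab]

variable {z}

theorem metric_inv (hz : z (Sum.inr 0) ∈ Set.Ioc 0 t₀) :
    (S.metric z)⁻¹ = Matrix.fromBlocks (S.G (z (Sum.inr 0)) (z (Sum.inr 1)))⁻¹ 0 0
      (Matrix.diagonal ![-((S.L (z (Sum.inr 0)) (z (Sum.inr 1))) ^ 2)⁻¹,
        (S.h (z (Sum.inr 0)) (z (Sum.inr 1)))⁻¹]) := by
  have hG := (S.posDef_G _ hz (z (Sum.inr 1))).det_pos.ne'
  have hL := (S.pos_L _ hz (z (Sum.inr 1))).ne'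
  have hh := (S.pos_h _ hz (z (Sum.inr 1))).ne'
  refine Matrix.inv_eq_right_inv ?_
  rw [metric, Matrix.fromBlocks_multiply, ← Matrix.fromBlocks_one]
  congr 1
  · rw [Matrix.mul_nonsing_inv _ (isUnit_iff_ne_zero.2 hG)]; simp
  · simp
  · simp
  · rw [Matrix.diagonal_mul_diagonal, ← Matrix.diagonal_one]
    rw [Matrix.zero_mul, zero_add]
    congr 1
    funext a
    fin_cases a
    · simp [hL]
    · simp [hh]

theorem hasDerivAt_L_fst {t : ℝ} (ht : t ∈ Set.Ioo 0 t₀) (y : ℝ) :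
    HasDerivAt (fun s => S.L s y) (deriv (fun s => S.L s y) t) t :=
  (hasDerivAt_fst_of_contDiffOn isOpen_Ioo
    (S.smooth_L.mono (Set.prod_mono Set.Ioo_subset_Ioc_self subset_rfl))
    ht y).differentiableAt.hasDerivAt

theorem hasDerivAt_h_fst {t : ℝ} (ht : t ∈ Set.Ioo 0 t₀) (y : ℝ) :
    HasDerivAt (fun s => S.h s y) (deriv (fun s => S.h s y) t) t :=
  (hasDerivAt_fst_of_contDiffOn isOpen_Ioo
    (S.smooth_h.mono (Set.prod_mono Set.Ioo_subset_Ioc_self subset_rfl))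
    ht y).differentiableAt.hasDerivAt

theorem hasDerivAt_L_snd {t : ℝ} (ht : t ∈ Set.Ioc 0 t₀) (y : ℝ) :
    HasDerivAt (S.L t) (deriv (S.L t) y) y :=
  (hasDerivAt_snd_of_contDiffOn S.smooth_L ht y).differentiableAt.hasDerivAt

theorem hasDerivAt_h_snd {t : ℝ} (ht : t ∈ Set.Ioc 0 t₀) (y : ℝ) :
    HasDerivAt (S.h t) (deriv (S.h t) y) y :=
  (hasDerivAt_snd_of_contDiffOn S.smooth_h ht y).differentiableAt.hasDerivAt

theorem pd_metric_LL_zero (hz : z (Sum.inr 0) ∈ Set.Ioo 0 t₀) :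
    pd (Sum.inr 0) (fun z => S.metric z (Sum.inr 0) (Sum.inr 0)) z
      = -(2 * S.L (z (Sum.inr 0)) (z (Sum.inr 1)) *
          deriv (fun s => S.L s (z (Sum.inr 1))) (z (Sum.inr 0))) := by
  have := ((S.hasDerivAt_L_fst hz (z (Sum.inr 1))).fun_pow 2).fun_neg
  simpa [pd, metric] using this.deriv

theorem pd_metric_LL_one (hz : z (Sum.inr 0) ∈ Set.Ioc 0 t₀) :
    pd (Sum.inr 1) (fun z => S.metric z (Sum.inr 0) (Sum.inr 0)) z
      = -(2 * S.L (z (Sum.inr 0)) (z (Sum.inr 1)) *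
          deriv (S.L (z (Sum.inr 0))) (z (Sum.inr 1))) := by
  have := ((S.hasDerivAt_L_snd hz (z (Sum.inr 1))).fun_pow 2).fun_neg
  simpa [pd, metric] using this.deriv

theorem pd_metric_hh_zero :
    pd (Sum.inr 0) (fun z => S.metric z (Sum.inr 1) (Sum.inr 1)) z
      = deriv (fun s => S.h s (z (Sum.inr 1))) (z (Sum.inr 0)) := by
  simp [pd, metric]

theorem pd_metric_hh_one :
    pd (Sum.inr 1) (fun z => S.metric z (Sum.inr 1) (Sum.inr 1)) z
      = deriv (S.h (z (Sum.inr 0))) (z (Sum.inr 1)) := by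
  simp [pd, metric]

theorem christoffel_inl_inl_inl (hz : z (Sum.inr 0) ∈ Set.Ioc 0 t₀) (K I J : Fin N) :
    christoffel S.metric (Sum.inl K) (Sum.inl I) (Sum.inl J) z = 0 := by
  simp [christoffel, S.metric_inv hz, Fintype.sum_sum_type, pd_metric_inl]

theorem christoffel_inr_inl_inr (hz : z (Sum.inr 0) ∈ Set.Ioc 0 t₀) (a b : Fin 2) (I : Fin N) :
    christoffel S.metric (Sum.inr a) (Sum.inl I) (Sum.inr b) z = 0 := by
  simp [christoffel, S.metric_inv hz, Fintype.sum_sum_type, pd_metric_inl, pd_metric_inl_inr]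

theorem christoffel_inr_inr_inl (hz : z (Sum.inr 0) ∈ Set.Ioc 0 t₀) (a b : Fin 2) (I : Fin N) :
    christoffel S.metric (Sum.inr a) (Sum.inr b) (Sum.inl I) z = 0 := by
  simp [christoffel, S.metric_inv hz, Fintype.sum_sum_type, pd_metric_inl, pd_metric_inl_inr,
    pd_metric_inr_inl]

theorem christoffel_zero_inl_inl (hz : z (Sum.inr 0) ∈ Set.Ioc 0 t₀) (I J : Fin N) :
    christoffel S.metric (Sum.inr 0) (Sum.inl I) (Sum.inl J) z =
      1 / 2 * (((S.L (z (Sum.inr 0)) (z (Sum.inr 1))) ^ 2)⁻¹ *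
        S.dtG (z (Sum.inr 0)) (z (Sum.inr 1)) I J) := by
  simp [christoffel, S.metric_inv hz, Fintype.sum_sum_type, pd_metric_inl,
    pd_metric_inl_inl_zero]

theorem christoffel_one_inl_inl (hz : z (Sum.inr 0) ∈ Set.Ioc 0 t₀) (I J : Fin N) :
    christoffel S.metric (Sum.inr 1) (Sum.inl I) (Sum.inl J) z =
      -(1 / 2 * ((S.h (z (Sum.inr 0)) (z (Sum.inr 1)))⁻¹ *
        S.dyG (z (Sum.inr 0)) (z (Sum.inr 1)) I J)) := by
  simp [christoffel, S.metric_inv hz, Fintype.sum_sum_type, pd_metric_inl,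
    pd_metric_inl_inl_one]

theorem christoffel_zero_zero_zero (hz : z (Sum.inr 0) ∈ Set.Ioo 0 t₀) :
    christoffel S.metric (Sum.inr 0) (Sum.inr 0) (Sum.inr 0) z =
      deriv (fun s => S.L s (z (Sum.inr 1))) (z (Sum.inr 0)) /
        S.L (z (Sum.inr 0)) (z (Sum.inr 1)) := by
  have hL := (S.pos_L _ (Set.Ioo_subset_Ioc_self hz) (z (Sum.inr 1))).ne'
  simp [christoffel, S.metric_inv (Set.Ioo_subset_Ioc_self hz), Fintype.sum_sum_type,
    S.pd_metric_LL_zero hz]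
  field_simp

theorem christoffel_zero_zero_one (hz : z (Sum.inr 0) ∈ Set.Ioo 0 t₀) :
    christoffel S.metric (Sum.inr 0) (Sum.inr 0) (Sum.inr 1) z =
      deriv (S.L (z (Sum.inr 0))) (z (Sum.inr 1)) / S.L (z (Sum.inr 0)) (z (Sum.inr 1)) := by
  have hL := (S.pos_L _ (Set.Ioo_subset_Ioc_self hz) (z (Sum.inr 1))).ne'
  have h0 := S.pd_metric_inr_inr_of_ne z (Sum.inr 0) (show (1 : Fin 2) ≠ 0 by decide)
  have h1 := S.pd_metric_inr_inr_of_ne z (Sum.inr 0) (show (0 : Fin 2) ≠ 1 by decide)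
  simp [christoffel, S.metric_inv (Set.Ioo_subset_Ioc_self hz), Fintype.sum_sum_type,
    S.pd_metric_LL_one (Set.Ioo_subset_Ioc_self hz), h0, h1]
  field_simp

theorem christoffel_one_one_zero (hz : z (Sum.inr 0) ∈ Set.Ioo 0 t₀) :
    christoffel S.metric (Sum.inr 1) (Sum.inr 1) (Sum.inr 0) z =
      deriv (fun s => S.h s (z (Sum.inr 1))) (z (Sum.inr 0)) /
        (2 * S.h (z (Sum.inr 0)) (z (Sum.inr 1))) := by
  have hL := (S.pos_h _ (Set.Ioo_subset_Ioc_self hz) (z (Sum.inr 1))).ne'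
  have h0 := S.pd_metric_inr_inr_of_ne z (Sum.inr 1) (show (1 : Fin 2) ≠ 0 by decide)
  have h1 := S.pd_metric_inr_inr_of_ne z (Sum.inr 1) (show (0 : Fin 2) ≠ 1 by decide)
  simp [christoffel, S.metric_inv (Set.Ioo_subset_Ioc_self hz), Fintype.sum_sum_type,
    pd_metric_hh_zero, h0, h1]
  field_simp

theorem christoffel_one_one_one (hz : z (Sum.inr 0) ∈ Set.Ioo 0 t₀) :
    christoffel S.metric (Sum.inr 1) (Sum.inr 1) (Sum.inr 1) z =
      deriv (S.h (z (Sum.inr 0))) (z (Sum.inr 1)) /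
        (2 * S.h (z (Sum.inr 0)) (z (Sum.inr 1))) := by
  have hL := (S.pos_h _ (Set.Ioo_subset_Ioc_self hz) (z (Sum.inr 1))).ne'
  simp [christoffel, S.metric_inv (Set.Ioo_subset_Ioc_self hz), Fintype.sum_sum_type,
    pd_metric_hh_one]
  field_simp

end Ricci

theorem smooth_G_interior : MatContDiffOn S.G (Set.Ioo 0 t₀ ×ˢ Set.univ) :=
  MatContDiffOn.mono (A := S.G) S.smooth_G (Set.prod_mono Set.Ioo_subset_Ioc_self subset_rfl)

theorem smooth_dtG : MatContDiffOn S.dtG (Set.Ioo 0 t₀ ×ˢ Set.univ) :=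
  S.smooth_G_interior.matDeriv_fst isOpen_Ioo

theorem smooth_dyG : MatContDiffOn S.dyG (Set.Ioc 0 t₀ ×ˢ Set.univ) :=
  MatContDiffOn.matDeriv_snd (A := S.G) (uniqueDiffOn_Ioc 0 t₀) S.smooth_G

theorem transpose_G {t : ℝ} (ht : t ∈ Set.Ioc 0 t₀) (y : ℝ) : (S.G t y).transpose = S.G t y := by
  have := (S.posDef_G t ht y).isHermitian
  rwa [Matrix.IsHermitian, Matrix.conjTranspose_eq_transpose_of_trivial] at this

theorem isUnit_det_G {t : ℝ} (ht : t ∈ Set.Ioc 0 t₀) (y : ℝ) : IsUnit (S.G t y).det :=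
  (S.posDef_G t ht y).det_pos.ne'.isUnit

theorem hasMatDerivAt_G_fst {t : ℝ} (ht : t ∈ Set.Ioo 0 t₀) (y : ℝ) :
    HasMatDerivAt (fun s => S.G s y) (S.dtG t y) t :=
  S.smooth_G_interior.hasMatDerivAt_fst isOpen_Ioo ht y

theorem hasMatDerivAt_G_snd {t : ℝ} (ht : t ∈ Set.Ioc 0 t₀) (y : ℝ) :
    HasMatDerivAt (S.G t) (S.dyG t y) y :=
  MatContDiffOn.hasMatDerivAt_snd (A := S.G) S.smooth_G ht y

theorem transpose_dtG {t : ℝ} (ht : t ∈ Set.Ioo 0 t₀) (y : ℝ) :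
    (S.dtG t y).transpose = S.dtG t y := by
  have h := (S.hasMatDerivAt_G_fst ht y).transpose
  have h' : HasMatDerivAt (fun s => (S.G s y).transpose) (S.dtG t y) t := by
    refine (S.hasMatDerivAt_G_fst ht y).congr_of_eventuallyEq ?_
    filter_upwards [isOpen_Ioo.mem_nhds ht] with s hs
    exact S.transpose_G (Set.Ioo_subset_Ioc_self hs) y
  exact h.matDeriv_eq.symm.trans h'.matDeriv_eq

theorem transpose_dyG {t : ℝ} (ht : t ∈ Set.Ioc 0 t₀) (y : ℝ) :
    (S.dyG t y).transpose = S.dyG t y := by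
  have h := (S.hasMatDerivAt_G_snd ht y).transpose
  have h' : HasMatDerivAt (fun z => (S.G t z).transpose) (S.dyG t y) y :=
    (S.hasMatDerivAt_G_snd ht y).congr_of_eventuallyEq
      (Filter.Eventually.of_forall fun z => S.transpose_G ht z)
  exact h.matDeriv_eq.symm.trans h'.matDeriv_eq

theorem christoffel_inl_inl_zero {z : Fin N ⊕ Fin 2 → ℝ} (hz : z (Sum.inr 0) ∈ Set.Ioo 0 t₀)
    (K I : Fin N) :
    christoffel S.metric (Sum.inl K) (Sum.inl I) (Sum.inr 0) z =
      1 / 2 * ((S.G (z (Sum.inr 0)) (z (Sum.inr 1)))⁻¹ *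
        S.dtG (z (Sum.inr 0)) (z (Sum.inr 1))) K I := by
  rw [← S.transpose_dtG hz, Matrix.mul_apply]
  simp [christoffel, S.metric_inv (Set.Ioo_subset_Ioc_self hz), Fintype.sum_sum_type,
    pd_metric_inl, pd_metric_inl_inl_zero]

theorem christoffel_inl_inl_one {z : Fin N ⊕ Fin 2 → ℝ} (hz : z (Sum.inr 0) ∈ Set.Ioc 0 t₀)
    (K I : Fin N) :
    christoffel S.metric (Sum.inl K) (Sum.inl I) (Sum.inr 1) z =
      1 / 2 * ((S.G (z (Sum.inr 0)) (z (Sum.inr 1)))⁻¹ *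
        S.dyG (z (Sum.inr 0)) (z (Sum.inr 1))) K I := by
  rw [← S.transpose_dyG hz, Matrix.mul_apply]
  simp [christoffel, S.metric_inv hz, Fintype.sum_sum_type, pd_metric_inl,
    pd_metric_inl_inl_one]

/-- The metric does not depend on the fibre coordinates, so the fibre derivatives in the Ricci
tensor drop out. -/
theorem pd_inl_christoffel {z : Fin N ⊕ Fin 2 → ℝ} (hz : z (Sum.inr 0) ∈ Set.Ioc 0 t₀)
    (J I : Fin N) (k : Fin N ⊕ Fin 2) :
    pd (Sum.inl J) (christoffel S.metric k (Sum.inl I) k) z = 0 := by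
  have h : ∀ s, christoffel S.metric k (Sum.inl I) k (Function.update z (Sum.inl J) s) = 0 := by
    intro s
    rcases k with K | a
    · exact S.christoffel_inl_inl_inl (by simpa using hz) K I K
    · exact S.christoffel_inr_inl_inr (by simpa using hz) a a I
  simp [pd, h]

theorem pd_inl_christoffel_inl {z : Fin N ⊕ Fin 2 → ℝ} (hz : z (Sum.inr 0) ∈ Set.Ioc 0 t₀)
    (K L I J : Fin N) :
    pd (Sum.inl L) (christoffel S.metric (Sum.inl K) (Sum.inl I) (Sum.inl J)) z = 0 := by
  have h : ∀ s, christoffel S.metric (Sum.inl K) (Sum.inl I) (Sum.inl J)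
      (Function.update z (Sum.inl L) s) = 0 := fun s =>
    S.christoffel_inl_inl_inl (by simpa using hz) K I J
  simp [pd, h]

theorem hasMatDerivAt_dtG {t : ℝ} (ht : t ∈ Set.Ioo 0 t₀) (y : ℝ) :
    HasMatDerivAt (fun s => S.dtG s y) (matDeriv (fun s => S.dtG s y) t) t :=
  S.smooth_dtG.hasMatDerivAt_fst isOpen_Ioo ht y

theorem hasMatDerivAt_dyG {t : ℝ} (ht : t ∈ Set.Ioc 0 t₀) (y : ℝ) :
    HasMatDerivAt (S.dyG t) (matDeriv (S.dyG t) y) y :=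
  S.smooth_dyG.hasMatDerivAt_snd ht y

theorem pd_christoffel_zero {t : ℝ} (ht : t ∈ Set.Ioo 0 t₀) (y : ℝ) (I J : Fin N) :
    pd (Sum.inr 0) (christoffel S.metric (Sum.inr 0) (Sum.inl I) (Sum.inl J))
      (Sum.elim 0 ![t, y]) = 1 / 2 * ((S.L t y ^ 2)⁻¹ * (matDeriv (fun s => S.dtG s y) t I J
        - 2 * (deriv (fun s => S.L s y) t / S.L t y) * S.dtG t y I J)) := by
  have hL := (S.pos_L _ (Set.Ioo_subset_Ioc_self ht) y).ne'
  have e : (fun s => christoffel S.metric (Sum.inr 0) (Sum.inl I) (Sum.inl J)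
      (Function.update (Sum.elim 0 ![t, y]) (Sum.inr 0) s)) =ᶠ[nhds t]
      fun s => 1 / 2 * ((S.L s y ^ 2)⁻¹ * S.dtG s y I J) := by
    filter_upwards [isOpen_Ioo.mem_nhds ht] with s hs
    rw [S.christoffel_zero_inl_inl (by simpa using Set.Ioo_subset_Ioc_self hs)]
    simp
  have h := (((((S.hasDerivAt_L_fst ht y).fun_pow 2).fun_inv (pow_ne_zero 2 hL)).fun_mul
    (S.hasMatDerivAt_dtG ht y I J)).const_mul (1 / 2)).deriv
  have h' : pd (Sum.inr 0) (christoffel S.metric (Sum.inr 0) (Sum.inl I) (Sum.inl J))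
      (Sum.elim 0 ![t, y]) = deriv (fun s => 1 / 2 * ((S.L s y ^ 2)⁻¹ * S.dtG s y I J)) t :=
    e.deriv_eq
  rw [h', h]
  simp only [Nat.cast_ofNat, Nat.add_one_sub_one, pow_one]
  field_simp
  ring

theorem pd_christoffel_one {t : ℝ} (ht : t ∈ Set.Ioc 0 t₀) (y : ℝ) (I J : Fin N) :
    pd (Sum.inr 1) (christoffel S.metric (Sum.inr 1) (Sum.inl I) (Sum.inl J))
      (Sum.elim 0 ![t, y]) = -(1 / 2 * ((S.h t y)⁻¹ * (matDeriv (S.dyG t) y I J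
        - deriv (S.h t) y / S.h t y * S.dyG t y I J))) := by
  have hh := (S.pos_h _ ht y).ne'
  have e : (fun s => christoffel S.metric (Sum.inr 1) (Sum.inl I) (Sum.inl J)
      (Function.update (Sum.elim 0 ![t, y]) (Sum.inr 1) s)) =
      fun s => -(1 / 2 * ((S.h t s)⁻¹ * S.dyG t s I J)) := by
    funext s
    rw [S.christoffel_one_inl_inl (by simpa using ht)]
    simp
  have h := ((((S.hasDerivAt_h_snd ht y).fun_inv hh).fun_mul
    (S.hasMatDerivAt_dyG ht y I J)).const_mul (1 / 2)).fun_neg.deriv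
  have h' : pd (Sum.inr 1) (christoffel S.metric (Sum.inr 1) (Sum.inl I) (Sum.inl J))
      (Sum.elim 0 ![t, y]) = deriv (fun s => -(1 / 2 * ((S.h t s)⁻¹ * S.dyG t s I J))) y :=
    congrArg (fun f => deriv f y) e
  rw [h', h]
  field_simp
  ring

/-- The fibre components of the Ricci tensor, before any gauge condition is used. -/
theorem ricci_inl_inl {t : ℝ} (ht : t ∈ Set.Ioo 0 t₀) (y : ℝ) (I J : Fin N) :
    2 * ricci S.metric (Sum.inl I) (Sum.inl J) (Sum.elim 0 ![t, y]) =
      ((S.L t y ^ 2)⁻¹ • (matDeriv (fun s => S.dtG s y) t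
          + (1 / 2 * ((S.G t y)⁻¹ * S.dtG t y).trace - deriv (fun s => S.L s y) t / S.L t y
            + deriv (fun s => S.h s y) t / (2 * S.h t y)) • S.dtG t y
          - S.dtG t y * ((S.G t y)⁻¹ * S.dtG t y))
        - (S.h t y)⁻¹ • (matDeriv (S.dyG t) y
          + (1 / 2 * ((S.G t y)⁻¹ * S.dyG t y).trace + deriv (S.L t) y / S.L t y
            - deriv (S.h t) y / (2 * S.h t y)) • S.dyG t y
          - S.dyG t y * ((S.G t y)⁻¹ * S.dyG t y))) I J := by
  have hz : (Sum.elim 0 ![t, y] : Fin N ⊕ Fin 2 → ℝ) (Sum.inr 0) ∈ Set.Ioo 0 t₀ := ht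
  have hz' := Set.Ioo_subset_Ioc_self hz
  have ht' := Set.Ioo_subset_Ioc_self ht
  have hGinv : (S.G t y)⁻¹.transpose = (S.G t y)⁻¹ := by
    rw [Matrix.transpose_nonsing_inv, S.transpose_G ht']
  -- the two products of Christoffel symbols that are quadratic in `∂G`
  have hsq : ∀ A : Matrix (Fin N) (Fin N) ℝ, A.transpose = A →
      (∑ K, ((S.G t y)⁻¹ * A) K J * A I K = (A * ((S.G t y)⁻¹ * A)) I J) ∧
      (∑ K, A J K * ((S.G t y)⁻¹ * A) K I = (A * ((S.G t y)⁻¹ * A)) I J) := by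
    intro A hA
    constructor
    · rw [Matrix.mul_apply]
      exact Finset.sum_congr rfl fun K _ => mul_comm _ _
    · have : (A * ((S.G t y)⁻¹ * A)).transpose = A * ((S.G t y)⁻¹ * A) := by
        rw [Matrix.transpose_mul, Matrix.transpose_mul, hA, hGinv, mul_assoc]
      rw [← Matrix.mul_apply, ← Matrix.transpose_apply (A * ((S.G t y)⁻¹ * A)) I J, this]
  obtain ⟨h1, h2⟩ := hsq _ (S.transpose_dtG ht y)
  obtain ⟨h3, h4⟩ := hsq _ (S.transpose_dyG ht' y)
  have e0 : (Sum.elim 0 ![t, y] : Fin N ⊕ Fin 2 → ℝ) (Sum.inr 0) = t := rfl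
  have e1 : (Sum.elim 0 ![t, y] : Fin N ⊕ Fin 2 → ℝ) (Sum.inr 1) = y := rfl
  simp only [ricci, Fintype.sum_sum_type, Fin.sum_univ_two, S.pd_inl_christoffel hz',
    S.pd_inl_christoffel_inl hz', S.christoffel_inl_inl_inl hz',
    S.christoffel_inr_inl_inr hz', S.christoffel_inr_inr_inl hz',
    S.christoffel_zero_inl_inl hz', S.christoffel_one_inl_inl hz',
    S.christoffel_inl_inl_zero hz, S.christoffel_inl_inl_one hz',
    S.christoffel_zero_zero_zero hz, S.christoffel_zero_zero_one hz,
    S.christoffel_one_one_zero hz, S.christoffel_one_one_one hz,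
    S.pd_christoffel_zero ht, S.pd_christoffel_one ht', e0, e1]
  simp only [mul_zero, sub_zero, zero_sub, zero_add, Finset.sum_const_zero]
  simp only [Finset.sum_add_distrib, Finset.sum_sub_distrib, Finset.sum_neg_distrib]
  have s1 : ∀ (a b : Fin N → ℝ) (c : ℝ),
      ∑ x, 1 / 2 * a x * (1 / 2 * (c * b x)) = c / 4 * ∑ x, a x * b x := by
    intro a b c; rw [Finset.mul_sum]; exact Finset.sum_congr rfl fun x _ => by ring
  have s2 : ∀ (a b : Fin N → ℝ) (c : ℝ),
      ∑ x, 1 / 2 * a x * -(1 / 2 * (c * b x)) = -(c / 4) * ∑ x, a x * b x := by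
    intro a b c; rw [Finset.mul_sum]; exact Finset.sum_congr rfl fun x _ => by ring
  have s3 : ∀ (a b : Fin N → ℝ) (c : ℝ),
      ∑ x, 1 / 2 * (c * b x) * (1 / 2 * a x) = c / 4 * ∑ x, b x * a x := by
    intro a b c; rw [Finset.mul_sum]; exact Finset.sum_congr rfl fun x _ => by ring
  have s4 : ∀ (a b : Fin N → ℝ) (c : ℝ),
      ∑ x, -(1 / 2 * (c * b x)) * (1 / 2 * a x) = -(c / 4) * ∑ x, b x * a x := by
    intro a b c; rw [Finset.mul_sum]; exact Finset.sum_congr rfl fun x _ => by ring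
  have s5 : ∀ (a : Fin N → ℝ) (c : ℝ), ∑ x, 1 / 2 * a x * c = c / 2 * ∑ x, a x := by
    intro a c; rw [Finset.mul_sum]; exact Finset.sum_congr rfl fun x _ => by ring
  rw [s1 (fun x => ((S.G t y)⁻¹ * S.dtG t y) x J) (fun x => S.dtG t y I x),
    s2 (fun x => ((S.G t y)⁻¹ * S.dyG t y) x J) (fun x => S.dyG t y I x),
    s3 (fun x => ((S.G t y)⁻¹ * S.dtG t y) x I) (fun x => S.dtG t y J x),
    s4 (fun x => ((S.G t y)⁻¹ * S.dyG t y) x I) (fun x => S.dyG t y J x),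
    s5, s5, h1, h2, h3, h4]
  simp only [Matrix.sub_apply, Matrix.add_apply, Matrix.smul_apply, smul_eq_mul, Matrix.trace,
    Matrix.diag_apply]
  ring

/-! ### The wave equation for the fibre metric -/

theorem trace_inv_mul_dtG (hareal : S.IsAreal) {t : ℝ} (ht : t ∈ Set.Ioo 0 t₀) (y : ℝ) :
    ((S.G t y)⁻¹ * S.dtG t y).trace = N / t := by
  have ht' := Set.Ioo_subset_Ioc_self ht
  have h1 := (S.hasMatDerivAt_G_fst ht y).det
  have h2 : HasDerivAt (fun s => (S.G s y).det) (N * t ^ (N - 1)) t := by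
    refine (hasDerivAt_pow N t).congr_of_eventuallyEq ?_
    filter_upwards [isOpen_Ioo.mem_nhds ht] with s hs
    exact hareal s (Set.Ioo_subset_Ioc_self hs) y
  have h3 := h1.unique h2
  have htN : t ^ N ≠ 0 := pow_ne_zero _ ht.1.ne'
  rw [Matrix.inv_def, Matrix.smul_mul, Matrix.trace_smul, h3, hareal t ht' y,
    Ring.inverse_eq_inv', smul_eq_mul]
  have ht0 := ht.1.ne'
  rcases N with _ | n
  · simp
  · simp only [Nat.add_sub_cancel]
    field_simp
    ring

theorem trace_inv_mul_dyG (hareal : S.IsAreal) {t : ℝ} (ht : t ∈ Set.Ioc 0 t₀) (y : ℝ) :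
    ((S.G t y)⁻¹ * S.dyG t y).trace = 0 := by
  have h1 := (S.hasMatDerivAt_G_snd ht y).det
  have h2 : HasDerivAt (fun z => (S.G t z).det) 0 y :=
    (hasDerivAt_const y (t ^ N)).congr_of_eventuallyEq
      (Filter.Eventually.of_forall fun z => hareal t ht z)
  rw [Matrix.inv_def, Matrix.smul_mul, Matrix.trace_smul, h1.unique h2, smul_zero]

/-- The fibre components of the vacuum Einstein equation, in divergence form: since the
determinant of the fibre metric is `tᴺ`, they say that
`∂ₜ (L⁻¹ √tᴺ √h G⁻¹ G_t) = ∂_y (L √tᴺ (√h)⁻¹ G⁻¹ G_y)`. -/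
theorem wave_equation (hvac : S.IsVacuum) (hareal : S.IsAreal) {t : ℝ} (ht : t ∈ Set.Ioo 0 t₀)
    (y : ℝ) : ∃ X,
      HasMatDerivAt (fun s => ((S.L s y)⁻¹ * √(s ^ N) * √(S.h s y)) •
        ((S.G s y)⁻¹ * S.dtG s y)) X t ∧
      HasMatDerivAt (fun z => (S.L t z * √(t ^ N) * (√(S.h t z))⁻¹) •
        ((S.G t z)⁻¹ * S.dyG t z)) X y := by
  have ht' := Set.Ioo_subset_Ioc_self ht
  have hL := (S.pos_L _ ht' y).ne'
  have hh0 := S.pos_h _ ht' y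
  have hh := hh0.ne'
  obtain ⟨k, hk⟩ : ∃ k, √(S.h t y) = k := ⟨_, rfl⟩
  have hsh : k ≠ 0 := hk ▸ (Real.sqrt_pos.2 hh0).ne'
  have hsq : S.h t y = k ^ 2 := hk ▸ (Real.sq_sqrt hh0.le).symm
  have htN : 0 < t ^ N := pow_pos ht.1 N
  have hst : √(t ^ N) ≠ 0 := (Real.sqrt_pos.2 htN).ne'
  have hdet := (S.isUnit_det_G ht' y).ne_zero
  have hr : HasDerivAt (fun s : ℝ => √(s ^ N)) (N / (2 * t) * √(t ^ N)) t := by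
    refine ((hasDerivAt_pow N t).sqrt htN.ne').congr_deriv ?_
    have ht0 := ht.1.ne'
    rcases N with _ | n
    · simp
    · simp only [Nat.add_sub_cancel]
      field_simp
      rw [Real.sq_sqrt htN.le]
      ring
  set α := N / (2 * t) - deriv (fun s => S.L s y) t / S.L t y
    + deriv (fun s => S.h s y) t / (2 * S.h t y) with hα
  set β := deriv (S.L t) y / S.L t y - deriv (S.h t) y / (2 * S.h t y) with hβ
  have hP : HasDerivAt (fun s => (S.L s y)⁻¹ * √(s ^ N) * √(S.h s y))
      (α * ((S.L t y)⁻¹ * √(t ^ N) * k)) t := by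
    refine ((((S.hasDerivAt_L_fst ht y).fun_inv hL).fun_mul hr).fun_mul
      ((S.hasDerivAt_h_fst ht y).sqrt hh)).congr_deriv ?_
    rw [hα]
    have ht0 := ht.1.ne'
    rw [hk, hsq]
    field_simp
    ring
  have hQ : HasDerivAt (fun z => S.L t z * √(t ^ N) * (√(S.h t z))⁻¹)
      (β * (S.L t y * √(t ^ N) * (k)⁻¹)) y := by
    refine (((S.hasDerivAt_L_snd ht' y).mul_const (√(t ^ N))).fun_mul
      (((S.hasDerivAt_h_snd ht' y).sqrt hh).fun_inv (hk ▸ hsh))).congr_deriv ?_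
    rw [hβ]
    rw [hk, hsq]
    field_simp
    ring
  have hU := ((S.hasMatDerivAt_G_fst ht y).inv hdet).mul (S.hasMatDerivAt_dtG ht y)
  have hW := ((S.hasMatDerivAt_G_snd ht' y).inv hdet).mul (S.hasMatDerivAt_dyG ht' y)
  refine ⟨_, HasMatDerivAt.smul hP hU, ?_⟩
  convert HasMatDerivAt.smul hQ hW using 1
  rw [hk]
  set A := matDeriv (fun s => S.dtG s y) t + α • S.dtG t y
    - S.dtG t y * ((S.G t y)⁻¹ * S.dtG t y) with hA
  set B := matDeriv (S.dyG t) y + β • S.dyG t y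
    - S.dyG t y * ((S.G t y)⁻¹ * S.dyG t y) with hB
  have hR : (S.L t y ^ 2)⁻¹ • A = (S.h t y)⁻¹ • B := by
    ext I J
    have h1 := S.ricci_inl_inl ht y I J
    rw [hvac _ (by simpa using ht), mul_zero, S.trace_inv_mul_dtG hareal ht,
      S.trace_inv_mul_dyG hareal ht'] at h1
    have h2 := sub_eq_zero.1 (h1.symm.trans rfl).symm.symm
    have e1 : 1 / 2 * ((N : ℝ) / t) = N / (2 * t) := by ring
    rw [e1, mul_zero, zero_add] at h2
    exact h2
  have h1 : ((S.L t y)⁻¹ * √(t ^ N) * k) • ((S.G t y)⁻¹ * A) =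
      (S.L t y * √(t ^ N) * (k)⁻¹) • ((S.G t y)⁻¹ * B) := by
    have h3 := congrArg (fun M => (S.L t y * √(t ^ N) * k) • ((S.G t y)⁻¹ * M)) hR
    simp only [Matrix.mul_smul, smul_smul] at h3
    convert h3 using 2
    · field_simp
    · rw [hsq]
      field_simp
  rw [hA, hB] at h1
  simp only [mul_sub, mul_add, Matrix.mul_smul, Matrix.neg_mul, mul_assoc] at h1 ⊢
  linear_combination (norm := module) h1

/-! ### The conserved density -/

theorem mu_eq (hareal : S.IsAreal) {t : ℝ} (ht : t ∈ Set.Ioo 0 t₀) (y : ℝ) :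
    S.mu t y = (S.L t y)⁻¹ * √(t ^ N) * √(S.h t y) * (N / t) := by
  have h : HasDerivAt (fun s => Real.log (S.G s y).det) (N / t) t := by
    have h1 : HasDerivAt (fun s : ℝ => N * Real.log s) (N / t) t := by
      simpa [div_eq_mul_inv] using (Real.hasDerivAt_log ht.1.ne').const_mul (N : ℝ)
    refine h1.congr_of_eventuallyEq ?_
    filter_upwards [isOpen_Ioo.mem_nhds ht] with s hs
    rw [hareal s (Set.Ioo_subset_Ioc_self hs) y, Real.log_pow]
  rw [mu, h.deriv, hareal t (Set.Ioo_subset_Ioc_self ht) y]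
  ring

/-- The density `μ` does not depend on time: this is the trace of the wave equation. -/
theorem mu_eq_mu (hvac : S.IsVacuum) (hareal : S.IsAreal) {s t : ℝ} (hs : s ∈ Set.Ioo 0 t₀)
    (ht : t ∈ Set.Ioo 0 t₀) (y : ℝ) : S.mu s y = S.mu t y := by
  have key : ∀ r ∈ Set.Ioo 0 t₀, HasDerivAt (fun r => S.mu r y) 0 r := by
    intro r hr
    obtain ⟨X, h1, h2⟩ := S.wave_equation hvac hareal hr y
    have h2' : HasDerivAt (fun _ : ℝ => (0 : ℝ)) X.trace y := by
      refine h2.trace.congr_of_eventuallyEq (Filter.Eventually.of_forall fun z => ?_)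
      simp only [Matrix.trace_smul, S.trace_inv_mul_dyG hareal (Set.Ioo_subset_Ioc_self hr),
        smul_zero]
    rw [← h2'.unique (hasDerivAt_const y 0)]
    refine h1.trace.congr_of_eventuallyEq ?_
    filter_upwards [isOpen_Ioo.mem_nhds hr] with q hq
    rw [S.mu_eq hareal hq, Matrix.trace_smul, S.trace_inv_mul_dtG hareal hq, smul_eq_mul]
  exact isOpen_Ioo.is_const_of_deriv_eq_zero isPreconnected_Ioo
    (fun r hr => (key r hr).differentiableAt.differentiableWithinAt)
    (fun r hr => (key r hr).deriv) hs ht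

/-- The time-independent coefficient `m` of the density `μ = m dy`, read off at time `t₀ / 2`. -/
def density (y : ℝ) : ℝ := S.mu (t₀ / 2) y

theorem half_mem (ht₀ : 0 < t₀) : t₀ / 2 ∈ Set.Ioo 0 t₀ := ⟨by linarith, by linarith⟩

theorem mu_eq_density (hvac : S.IsVacuum) (hareal : S.IsAreal) {t : ℝ} (ht : t ∈ Set.Ioo 0 t₀)
    (y : ℝ) : S.mu t y = S.density y :=
  S.mu_eq_mu hvac hareal ht (half_mem (ht.1.trans ht.2)) y

/-- For `N = 0` the density vanishes, since `∂ₜ ln det G = N / t`. -/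
theorem density_pos (hN : 1 ≤ N) (hareal : S.IsAreal) (ht₀ : 0 < t₀) (y : ℝ) :
    0 < S.density y := by
  have h := half_mem ht₀
  have h' := Set.Ioo_subset_Ioc_self h
  have hL := S.pos_L _ h' y
  have hh := Real.sqrt_pos.2 (S.pos_h _ h' y)
  have ht := Real.sqrt_pos.2 (pow_pos h.1 N)
  have hN' : (0 : ℝ) < N := by exact_mod_cast hN
  rw [density, S.mu_eq hareal h]
  have := h.1
  positivity

theorem density_periodic (hareal : S.IsAreal) (ht₀ : 0 < t₀) :
    Function.Periodic S.density 1 := by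
  intro y
  have h := half_mem ht₀
  have h' := Set.Ioo_subset_Ioc_self h
  rw [density, density, S.mu_eq hareal h, S.mu_eq hareal h, S.periodic_L _ h', S.periodic_h _ h']

theorem contDiff_density (hareal : S.IsAreal) (ht₀ : 0 < t₀) : ContDiff ℝ ∞ S.density := by
  have h := half_mem ht₀
  have h' := Set.Ioo_subset_Ioc_self h
  have e : S.density = fun y =>
      (S.L (t₀ / 2) y)⁻¹ * √((t₀ / 2) ^ N) * √(S.h (t₀ / 2) y) * (N / (t₀ / 2)) := by
    funext y; exact S.mu_eq hareal h y
  have slice : ∀ {f : ℝ → ℝ → ℝ},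
      ContDiffOn ℝ ∞ (fun p : ℝ × ℝ => f p.1 p.2) (Set.Ioc 0 t₀ ×ˢ Set.univ) →
      ContDiff ℝ ∞ (f (t₀ / 2)) := fun hf => by
    rw [← contDiffOn_univ]
    exact hf.comp (f := fun y : ℝ => (t₀ / 2, y)) (contDiff_const.prodMk contDiff_id).contDiffOn
      (fun y _ => ⟨h', trivial⟩)
  rw [e]
  exact ((((slice S.smooth_L).inv fun y => (S.pos_L _ h' y).ne').mul contDiff_const).mul
    ((slice S.smooth_h).sqrt fun y => (S.pos_h _ h' y).ne')).mul contDiff_const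

/-! ### The evolution equation in logarithmic time -/

theorem exp_neg_mem_Ioo {τ₀ τ : ℝ} (ht₀ : t₀ = Real.exp (-τ₀)) (hτ : τ ∈ Set.Ioi τ₀) :
    Real.exp (-τ) ∈ Set.Ioo 0 t₀ :=
  ⟨Real.exp_pos _, ht₀ ▸ Real.exp_lt_exp.2 (neg_lt_neg hτ)⟩

theorem exp_neg_mem_Ioc {τ₀ τ : ℝ} (ht₀ : t₀ = Real.exp (-τ₀)) (hτ : τ ∈ Set.Ici τ₀) :
    Real.exp (-τ) ∈ Set.Ioc 0 t₀ :=
  ⟨Real.exp_pos _, ht₀ ▸ Real.exp_le_exp.2 (neg_le_neg hτ)⟩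

/-- The spatial logarithmic derivative `G⁻¹ G_y`, at time `t = e^{-τ}`. -/
def spatialVelocity (τ y : ℝ) : Matrix (Fin N) (Fin N) ℝ :=
  (S.G (Real.exp (-τ)) y)⁻¹ * S.dyG (Real.exp (-τ)) y

theorem hasDerivAt_exp_neg (τ : ℝ) :
    HasDerivAt (fun s => Real.exp (-s)) (-Real.exp (-τ)) τ := by
  simpa using (hasDerivAt_id τ).neg.exp

section LogTime

variable {τ₀ : ℝ}

theorem velocity_eq (ht₀ : t₀ = Real.exp (-τ₀)) {τ : ℝ} (hτ : τ ∈ Set.Ioi τ₀) (y : ℝ) :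
    S.velocity τ y = -Real.exp (-τ) •
      ((S.G (Real.exp (-τ)) y)⁻¹ * S.dtG (Real.exp (-τ)) y) := by
  have h := (S.hasMatDerivAt_G_fst (exp_neg_mem_Ioo ht₀ hτ) y).comp (u := fun s => Real.exp (-s))
    (hasDerivAt_exp_neg τ)
  rw [velocity, h.matDeriv_eq, Matrix.mul_smul]

/-- The wave equation in logarithmic time: `V = G⁻¹ G_τ` and `W = G⁻¹ G_y` satisfy
`(m⁻¹ W)_y = (m / (N² e^{-Nτ})) V_τ`. -/
theorem hasMatDerivAt_velocity_and_spatialVelocity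
    (ht₀ : t₀ = Real.exp (-τ₀)) (hN : 1 ≤ N) (hvac : S.IsVacuum)
    (hareal : S.IsAreal) {τ : ℝ} (hτ : τ ∈ Set.Ioi τ₀) (y : ℝ) :
    HasMatDerivAt (fun s => S.velocity s y) (S.acceleration τ y) τ ∧
      HasMatDerivAt (fun z => (S.density z)⁻¹ • S.spatialVelocity τ z)
        ((S.density y / (N ^ 2 * Real.exp (-τ) ^ N)) • S.acceleration τ y) y := by
  have ht := exp_neg_mem_Ioo ht₀ hτ
  have ht' := Set.Ioo_subset_Ioc_self ht
  have ht₀' : 0 < t₀ := ht.1.trans ht.2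
  have hN' : (N : ℝ) ≠ 0 := by exact_mod_cast (by omega : N ≠ 0)
  have hm := fun z => (S.density_pos hN hareal ht₀' z).ne'
  have hdens : ∀ s ∈ Set.Ioi τ₀, ∀ z, S.density z = (S.L (Real.exp (-s)) z)⁻¹ *
      √(Real.exp (-s) ^ N) * √(S.h (Real.exp (-s)) z) * (N / Real.exp (-s)) := by
    intro s hs z
    rw [← S.mu_eq_density hvac hareal (exp_neg_mem_Ioo ht₀ hs), S.mu_eq hareal
      (exp_neg_mem_Ioo ht₀ hs)]
  obtain ⟨X, h1, h2⟩ := S.wave_equation hvac hareal ht y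
  have h3 : HasMatDerivAt (fun s => S.velocity s y)
      ((N / S.density y * Real.exp (-τ)) • X) τ := by
    have h4 := (HasMatDerivAt.smul (hasDerivAt_const τ (-(N / S.density y)))
      (h1.comp (u := fun s => Real.exp (-s))
    (hasDerivAt_exp_neg τ)))
    rw [zero_smul, zero_add, smul_smul, neg_mul_neg] at h4
    refine h4.congr_of_eventuallyEq ?_
    filter_upwards [isOpen_Ioi.mem_nhds hτ] with s hs
    rw [S.velocity_eq ht₀ hs, smul_smul]
    congr 1
    have h5 := hm y
    rw [hdens s hs y] at h5 ⊢
    have h6 := (Real.exp_pos (-s)).ne'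
    have h7 : (S.L (Real.exp (-s)) y)⁻¹ * √(Real.exp (-s) ^ N) * √(S.h (Real.exp (-s)) y) ≠ 0 :=
      left_ne_zero_of_mul h5
    generalize (S.L (Real.exp (-s)) y)⁻¹ * √(Real.exp (-s) ^ N) * √(S.h (Real.exp (-s)) y) = P
      at h7 ⊢
    field_simp
  have hacc : S.acceleration τ y = (N / S.density y * Real.exp (-τ)) • X := h3.matDeriv_eq
  refine ⟨hacc ▸ h3, ?_⟩
  have he := (Real.exp_pos (-τ)).ne'
  have h4 := HasMatDerivAt.smul (hasDerivAt_const y (Real.exp (-τ) / (N * Real.exp (-τ) ^ N))) h2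
  rw [zero_smul, zero_add] at h4
  have e : (S.density y / (N ^ 2 * Real.exp (-τ) ^ N)) • S.acceleration τ y =
      (Real.exp (-τ) / (N * Real.exp (-τ) ^ N)) • X := by
    rw [hacc, smul_smul]
    congr 1
    have := hm y
    field_simp
  rw [e]
  refine h4.congr_of_eventuallyEq (Filter.Eventually.of_forall fun z => ?_)
  simp only [smul_smul, spatialVelocity]
  congr 1
  have h5 := (S.pos_L _ ht' z).ne'
  have h6 := (Real.sqrt_pos.2 (S.pos_h _ ht' z)).ne'
  have h7 := Real.sqrt_pos.2 (pow_pos ht.1 N)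
  have h8 := h7.ne'
  rw [hdens τ hτ z]
  field_simp
  rw [Real.sq_sqrt (pow_pos ht.1 N).le]

theorem smooth_comp_exp_neg (ht₀ : t₀ = Real.exp (-τ₀))
    {A : ℝ → ℝ → Matrix (Fin N) (Fin N) ℝ}
    (hA : MatContDiffOn A (Set.Ioc 0 t₀ ×ˢ Set.univ)) :
    MatContDiffOn (fun τ y => A (Real.exp (-τ)) y) (Set.Ici τ₀ ×ˢ Set.univ) := fun i j => by
  have h : ContDiff ℝ ∞ (fun p : ℝ × ℝ => (Real.exp (-p.1), p.2)) :=
    (contDiff_fst.neg.exp).prodMk contDiff_snd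
  exact (hA i j).comp h.contDiffOn fun p hp => ⟨exp_neg_mem_Ioc ht₀ hp.1, trivial⟩

theorem smooth_G_exp (ht₀ : t₀ = Real.exp (-τ₀)) :
    MatContDiffOn (fun τ y => S.G (Real.exp (-τ)) y) (Set.Ici τ₀ ×ˢ Set.univ) :=
  smooth_comp_exp_neg (A := S.G) ht₀ S.smooth_G

theorem smooth_G_exp_inv (ht₀ : t₀ = Real.exp (-τ₀)) :
    MatContDiffOn (fun τ y => (S.G (Real.exp (-τ)) y)⁻¹) (Set.Ici τ₀ ×ˢ Set.univ) :=
  (S.smooth_G_exp ht₀).inv fun p hp =>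
    (S.isUnit_det_G (exp_neg_mem_Ioc ht₀ hp.1) p.2).ne_zero

theorem smooth_spatialVelocity (ht₀ : t₀ = Real.exp (-τ₀)) :
    MatContDiffOn S.spatialVelocity (Set.Ici τ₀ ×ˢ Set.univ) :=
  (S.smooth_G_exp_inv ht₀).mul (smooth_comp_exp_neg ht₀ S.smooth_dyG)

theorem Ioi_prod_subset : Set.Ioi τ₀ ×ˢ (Set.univ : Set ℝ) ⊆ Set.Ici τ₀ ×ˢ Set.univ :=
  Set.prod_mono Set.Ioi_subset_Ici_self subset_rfl

theorem smooth_velocity (ht₀ : t₀ = Real.exp (-τ₀)) :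
    MatContDiffOn S.velocity (Set.Ioi τ₀ ×ˢ Set.univ) :=
  ((S.smooth_G_exp_inv ht₀).mono Ioi_prod_subset).mul
    (((S.smooth_G_exp ht₀).mono Ioi_prod_subset).matDeriv_fst isOpen_Ioi)

theorem smooth_acceleration (ht₀ : t₀ = Real.exp (-τ₀)) :
    MatContDiffOn S.acceleration (Set.Ioi τ₀ ×ˢ Set.univ) :=
  (S.smooth_velocity ht₀).matDeriv_fst isOpen_Ioi

/-- The structure equation for the two logarithmic derivatives `V = G⁻¹ G_τ` and `W = G⁻¹ G_y`:
`W_τ + V W = V_y + W V`. -/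
theorem matDeriv_spatialVelocity (ht₀ : t₀ = Real.exp (-τ₀)) {τ : ℝ} (hτ : τ ∈ Set.Ioi τ₀) (y : ℝ) :
    matDeriv (fun s => S.spatialVelocity s y) τ + S.velocity τ y * S.spatialVelocity τ y =
      matDeriv (S.velocity τ) y + S.spatialVelocity τ y * S.velocity τ y := by
  have hg := (S.smooth_G_exp ht₀).mono Ioi_prod_subset
  have hdet := (S.isUnit_det_G (exp_neg_mem_Ioc ht₀ (Set.Ioi_subset_Ici_self hτ)) y).ne_zero
  have h1 := ((hg.hasMatDerivAt_fst isOpen_Ioi hτ y).inv hdet).mul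
    ((hg.matDeriv_snd isOpen_Ioi.uniqueDiffOn).hasMatDerivAt_fst isOpen_Ioi hτ y)
  have h2 := ((hg.hasMatDerivAt_snd hτ y).inv hdet).mul
    ((hg.matDeriv_fst isOpen_Ioi).hasMatDerivAt_snd hτ y)
  have e1 : matDeriv (fun s => S.spatialVelocity s y) τ = _ := h1.matDeriv_eq
  have e2 : matDeriv (S.velocity τ) y = _ := h2.matDeriv_eq
  rw [e1, e2, hg.matDeriv_comm isOpen_Ioi hτ y]
  simp only [spatialVelocity, velocity, dyG]
  noncomm_ring

end LogTime

end GowdySpacetime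

/-! ### Positivity of the trace form on self-adjoint endomorphisms -/

open scoped MatrixOrder in
/-- The square of an endomorphism which is self-adjoint for an inner product has nonnegative
trace. -/
theorem trace_mul_self_nonneg_of_selfAdjoint {N : ℕ} {G X : Matrix (Fin N) (Fin N) ℝ}
    (hG : G.PosDef) (hX : (G * X).transpose = G * X) : 0 ≤ (X * X).trace := by
  have hdet : IsUnit G.det := hG.det_pos.ne'.isUnit
  obtain ⟨C, hC⟩ : ∃ C, G⁻¹ = Matrix.conjTranspose C * C :=
    CStarAlgebra.nonneg_iff_eq_star_mul_self.1 hG.inv.posSemidef.nonneg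
  have h1 : X = G⁻¹ * (G * X) := by rw [← mul_assoc, Matrix.nonsing_inv_mul _ hdet, one_mul]
  have h2 : (G * X).conjTranspose = G * X := by
    rwa [Matrix.conjTranspose_eq_transpose_of_trivial]
  have h3 : (X * X).trace = (C * (G * X) * C.conjTranspose *
      (C * (G * X) * C.conjTranspose).conjTranspose).trace := by
    have h4 : X * X = G⁻¹ * (G * X) * (G⁻¹ * (G * X)) := by rw [← h1]
    rw [h4]
    generalize G * X = B at h2 ⊢
    rw [Matrix.conjTranspose_mul, Matrix.conjTranspose_mul, Matrix.conjTranspose_conjTranspose,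
      h2, hC]
    simp only [mul_assoc]
    rw [Matrix.trace_mul_comm]
    simp only [mul_assoc]
  rw [h3]
  exact (Matrix.posSemidef_self_mul_conjTranspose _).trace_nonneg

/-! ### Integrals over the circle depending on a parameter -/

theorem continuousOn_integral_of_continuousOn_strip {T : Set ℝ} {f : ℝ → ℝ → ℝ}
    (hf : ContinuousOn (fun p : ℝ × ℝ => f p.1 p.2) (T ×ˢ Set.univ)) :
    ContinuousOn (fun τ => ∫ y in (0 : ℝ)..1, f τ y) T := by
  rw [continuousOn_iff_continuous_domRestrict]
  refine intervalIntegral.continuous_parametric_intervalIntegral_of_continuous'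
    (f := fun (τ : T) y => f τ y) ?_ 0 1
  exact hf.comp_continuous ((continuous_subtype_val.comp continuous_fst).prodMk continuous_snd)
    fun p => ⟨p.1.2, trivial⟩

theorem continuous_slice_of_continuousOn_strip {T : Set ℝ} {f : ℝ → ℝ → ℝ}
    (hf : ContinuousOn (fun p : ℝ × ℝ => f p.1 p.2) (T ×ˢ Set.univ)) {τ : ℝ} (hτ : τ ∈ T) :
    Continuous (f τ) :=
  hf.comp_continuous (continuous_const.prodMk continuous_id) fun _ => ⟨hτ, trivial⟩

namespace GowdySpacetime

variable {N : ℕ} {t₀ : ℝ} (S : GowdySpacetime N t₀)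

/-! ### Equivariance and self-adjointness of the logarithmic derivatives -/

theorem hol_mul_inv : (S.hol : Matrix (Fin N) (Fin N) ℝ) *
    ((S.hol⁻¹ : Matrix.SpecialLinearGroup (Fin N) ℝ) : Matrix (Fin N) (Fin N) ℝ) = 1 := by
  rw [← Matrix.SpecialLinearGroup.coe_mul, mul_inv_cancel, Matrix.SpecialLinearGroup.coe_one]

/-- The endomorphism `G⁻¹ B` associated with an equivariant bilinear form `B` is conjugated by
the holonomy under `y ↦ y + 1`. -/
theorem inv_G_add_one_mul {t : ℝ} (ht : t ∈ Set.Ioc 0 t₀) (y : ℝ)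
    (B : Matrix (Fin N) (Fin N) ℝ) :
    (S.G t (y + 1))⁻¹ * ((S.hol : Matrix (Fin N) (Fin N) ℝ).transpose * B *
        (S.hol : Matrix (Fin N) (Fin N) ℝ)) =
      ((S.hol⁻¹ : Matrix.SpecialLinearGroup (Fin N) ℝ) : Matrix (Fin N) (Fin N) ℝ) *
        ((S.G t y)⁻¹ * B) * (S.hol : Matrix (Fin N) (Fin N) ℝ) := by
  have h1 : (S.hol : Matrix (Fin N) (Fin N) ℝ)⁻¹ =
      ((S.hol⁻¹ : Matrix.SpecialLinearGroup (Fin N) ℝ) : Matrix (Fin N) (Fin N) ℝ) :=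
    Matrix.inv_eq_right_inv S.hol_mul_inv
  have h2 : IsUnit (S.hol : Matrix (Fin N) (Fin N) ℝ).transpose.det := by
    rw [Matrix.det_transpose, S.hol.det_coe]; exact isUnit_one
  rw [S.equivariant_G t ht, Matrix.mul_inv_rev, Matrix.mul_inv_rev, h1]
  simp only [mul_assoc]
  rw [Matrix.nonsing_inv_mul_cancel_left _ _ h2]

theorem dyG_add_one {t : ℝ} (ht : t ∈ Set.Ioc 0 t₀) (y : ℝ) :
    S.dyG t (y + 1) = (S.hol : Matrix (Fin N) (Fin N) ℝ).transpose * S.dyG t y *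
      (S.hol : Matrix (Fin N) (Fin N) ℝ) := by
  have h1 := (S.hasMatDerivAt_G_snd ht (y + 1)).comp_add_const
  have h2 := ((HasMatDerivAt.const (S.hol : Matrix (Fin N) (Fin N) ℝ).transpose y).mul
    (S.hasMatDerivAt_G_snd ht y)).mul (HasMatDerivAt.const (S.hol : Matrix (Fin N) (Fin N) ℝ) y)
  have h3 := h1.congr_of_eventuallyEq (B := fun z => (S.hol : Matrix (Fin N) (Fin N) ℝ).transpose *
    S.G t z * (S.hol : Matrix (Fin N) (Fin N) ℝ))
    (Filter.Eventually.of_forall fun z => (S.equivariant_G t ht z).symm)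
  simpa using h3.matDeriv_eq.symm.trans h2.matDeriv_eq

theorem dtG_add_one {t : ℝ} (ht : t ∈ Set.Ioo 0 t₀) (y : ℝ) :
    S.dtG t (y + 1) = (S.hol : Matrix (Fin N) (Fin N) ℝ).transpose * S.dtG t y *
      (S.hol : Matrix (Fin N) (Fin N) ℝ) := by
  have h2 := ((HasMatDerivAt.const (S.hol : Matrix (Fin N) (Fin N) ℝ).transpose t).mul
    (S.hasMatDerivAt_G_fst ht y)).mul (HasMatDerivAt.const (S.hol : Matrix (Fin N) (Fin N) ℝ) t)
  have h3 := h2.congr_of_eventuallyEq (B := fun s => S.G s (y + 1)) (by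
    filter_upwards [isOpen_Ioo.mem_nhds ht] with s hs
    exact S.equivariant_G s (Set.Ioo_subset_Ioc_self hs) y)
  simpa [dtG] using h3.matDeriv_eq

variable {τ₀ : ℝ}

theorem spatialVelocity_add_one (ht₀ : t₀ = Real.exp (-τ₀)) {τ : ℝ} (hτ : τ ∈ Set.Ici τ₀) (y : ℝ) :
    S.spatialVelocity τ (y + 1) =
      ((S.hol⁻¹ : Matrix.SpecialLinearGroup (Fin N) ℝ) : Matrix (Fin N) (Fin N) ℝ) *
        S.spatialVelocity τ y * (S.hol : Matrix (Fin N) (Fin N) ℝ) := by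
  have ht := exp_neg_mem_Ioc ht₀ hτ
  rw [spatialVelocity, S.dyG_add_one ht, S.inv_G_add_one_mul ht, spatialVelocity]

theorem velocity_add_one (ht₀ : t₀ = Real.exp (-τ₀)) {τ : ℝ} (hτ : τ ∈ Set.Ioi τ₀) (y : ℝ) :
    S.velocity τ (y + 1) =
      ((S.hol⁻¹ : Matrix.SpecialLinearGroup (Fin N) ℝ) : Matrix (Fin N) (Fin N) ℝ) *
        S.velocity τ y * (S.hol : Matrix (Fin N) (Fin N) ℝ) := by
  have ht := exp_neg_mem_Ioo ht₀ hτ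
  rw [S.velocity_eq ht₀ hτ, S.dtG_add_one ht, S.inv_G_add_one_mul (Set.Ioo_subset_Ioc_self ht),
    S.velocity_eq ht₀ hτ, Matrix.mul_smul, Matrix.smul_mul]

/-- The trace of a product of two sections of the endomorphism bundle is a function on the
circle. -/
theorem trace_mul_hol_conj (A B : Matrix (Fin N) (Fin N) ℝ) :
    ((((S.hol⁻¹ : Matrix.SpecialLinearGroup (Fin N) ℝ) : Matrix (Fin N) (Fin N) ℝ) * A *
        (S.hol : Matrix (Fin N) (Fin N) ℝ)) *
      (((S.hol⁻¹ : Matrix.SpecialLinearGroup (Fin N) ℝ) : Matrix (Fin N) (Fin N) ℝ) * B *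
        (S.hol : Matrix (Fin N) (Fin N) ℝ))).trace = (A * B).trace := by
  rw [Matrix.trace_mul_comm]
  simp only [mul_assoc]
  rw [← mul_assoc (S.hol : Matrix (Fin N) (Fin N) ℝ), S.hol_mul_inv, one_mul,
    Matrix.trace_mul_comm]
  simp only [mul_assoc]
  rw [S.hol_mul_inv, mul_one, Matrix.trace_mul_comm]

theorem transpose_G_mul_spatialVelocity (ht₀ : t₀ = Real.exp (-τ₀)) {τ : ℝ}
    (hτ : τ ∈ Set.Ici τ₀) (y : ℝ) :
    (S.G (Real.exp (-τ)) y * S.spatialVelocity τ y).transpose =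
      S.G (Real.exp (-τ)) y * S.spatialVelocity τ y := by
  have ht := exp_neg_mem_Ioc ht₀ hτ
  rw [spatialVelocity, Matrix.mul_nonsing_inv_cancel_left _ _ (S.isUnit_det_G ht y),
    S.transpose_dyG ht]

theorem transpose_G_mul_velocity (ht₀ : t₀ = Real.exp (-τ₀)) {τ : ℝ}
    (hτ : τ ∈ Set.Ioi τ₀) (y : ℝ) :
    (S.G (Real.exp (-τ)) y * S.velocity τ y).transpose =
      S.G (Real.exp (-τ)) y * S.velocity τ y := by
  have ht := exp_neg_mem_Ioo ht₀ hτ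
  rw [S.velocity_eq ht₀ hτ, Matrix.mul_smul, Matrix.mul_nonsing_inv_cancel_left _ _
    (S.isUnit_det_G (Set.Ioo_subset_Ioc_self ht) y), Matrix.transpose_smul, S.transpose_dtG ht]

theorem trace_spatialVelocity_sq_nonneg (ht₀ : t₀ = Real.exp (-τ₀)) {τ : ℝ}
    (hτ : τ ∈ Set.Ici τ₀) (y : ℝ) :
    0 ≤ (S.spatialVelocity τ y * S.spatialVelocity τ y).trace :=
  trace_mul_self_nonneg_of_selfAdjoint (S.posDef_G _ (exp_neg_mem_Ioc ht₀ hτ) y)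
    (S.transpose_G_mul_spatialVelocity ht₀ hτ y)

theorem trace_velocity_sq_nonneg (ht₀ : t₀ = Real.exp (-τ₀)) {τ : ℝ}
    (hτ : τ ∈ Set.Ioi τ₀) (y : ℝ) : 0 ≤ (S.velocity τ y * S.velocity τ y).trace :=
  trace_mul_self_nonneg_of_selfAdjoint
    (S.posDef_G _ (exp_neg_mem_Ioc ht₀ (Set.Ioi_subset_Ici_self hτ)) y)
    (S.transpose_G_mul_velocity ht₀ hτ y)

/-! ### The energy inequality -/

/-- The factor `N² e^{-Nτ}`: the square of the propagation speed with respect to the density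
`μ` and logarithmic time. -/
def speedSq (N : ℕ) (τ : ℝ) : ℝ := N ^ 2 * Real.exp (-τ) ^ N

theorem speedSq_nonneg (τ : ℝ) : 0 ≤ speedSq N τ := by unfold speedSq; positivity

theorem contDiff_speedSq : ContDiff ℝ ∞ (speedSq N) :=
  contDiff_const.mul ((contDiff_neg.exp).pow N)

theorem hasDerivAt_speedSq (τ : ℝ) : HasDerivAt (speedSq N) (-N * speedSq N τ) τ := by
  refine (((hasDerivAt_exp_neg τ).fun_pow N).const_mul ((N : ℝ) ^ 2)).congr_deriv ?_
  unfold speedSq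
  rcases N with _ | n
  · simp
  · simp only [Nat.add_sub_cancel]
    ring

/-- The spatial part `Tr (W²) / m` of the energy density, `W = G⁻¹ G_y`. -/
def spatialDensity (τ y : ℝ) : ℝ :=
  (S.spatialVelocity τ y * S.spatialVelocity τ y).trace / S.density y

/-- The energy density `½ (Tr (V²) m + N² e^{-Nτ} Tr (W²) / m)`, with `V = G⁻¹ G_τ` and
`W = G⁻¹ G_y`. -/
def energyDensity (τ y : ℝ) : ℝ :=
  1 / 2 * ((S.velocity τ y * S.velocity τ y).trace * S.density y +
    speedSq N τ * S.spatialDensity τ y)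

/-- The energy flux `N² e^{-Nτ} Tr (V W) / m`. -/
def energyFlux (τ y : ℝ) : ℝ :=
  speedSq N τ * (S.velocity τ y * ((S.density y)⁻¹ • S.spatialVelocity τ y)).trace

theorem contDiffOn_density (hareal : S.IsAreal) (ht₀ : t₀ = Real.exp (-τ₀)) (Ω : Set (ℝ × ℝ)) :
    ContDiffOn ℝ ∞ (fun p : ℝ × ℝ => S.density p.2) Ω :=
  ((S.contDiff_density hareal (ht₀ ▸ Real.exp_pos _)).comp contDiff_snd).contDiffOn

theorem contDiffOn_speedSq (Ω : Set (ℝ × ℝ)) :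
    ContDiffOn ℝ ∞ (fun p : ℝ × ℝ => speedSq N p.1) Ω :=
  (contDiff_speedSq.comp contDiff_fst).contDiffOn

theorem smooth_spatialDensity (hN : 1 ≤ N) (hareal : S.IsAreal) (ht₀ : t₀ = Real.exp (-τ₀)) :
    ContDiffOn ℝ ∞ (fun p : ℝ × ℝ => S.spatialDensity p.1 p.2) (Set.Ici τ₀ ×ˢ Set.univ) :=
  ((S.smooth_spatialVelocity ht₀).mul (S.smooth_spatialVelocity ht₀)).trace.div
    (S.contDiffOn_density hareal ht₀ _)
    fun p _ => (S.density_pos hN hareal (ht₀ ▸ Real.exp_pos _) p.2).ne'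

theorem smooth_energyDensity (hN : 1 ≤ N) (hareal : S.IsAreal) (ht₀ : t₀ = Real.exp (-τ₀)) :
    ContDiffOn ℝ ∞ (fun p : ℝ × ℝ => S.energyDensity p.1 p.2) (Set.Ioi τ₀ ×ˢ Set.univ) :=
  contDiffOn_const.mul ((((S.smooth_velocity ht₀).mul (S.smooth_velocity ht₀)).trace.mul
    (S.contDiffOn_density hareal ht₀ _)).add ((contDiffOn_speedSq _).mul
    ((S.smooth_spatialDensity hN hareal ht₀).mono Ioi_prod_subset)))

theorem smooth_energyFlux (hN : 1 ≤ N) (hareal : S.IsAreal) (ht₀ : t₀ = Real.exp (-τ₀)) :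
    ContDiffOn ℝ ∞ (fun p : ℝ × ℝ => S.energyFlux p.1 p.2) (Set.Ioi τ₀ ×ˢ Set.univ) :=
  (contDiffOn_speedSq _).mul ((S.smooth_velocity ht₀).mul
    (MatContDiffOn.smul (c := fun _ y => (S.density y)⁻¹)
      ((S.contDiffOn_density hareal ht₀ _).inv
        fun p _ => (S.density_pos hN hareal (ht₀ ▸ Real.exp_pos _) p.2).ne')
      ((S.smooth_spatialVelocity ht₀).mono Ioi_prod_subset))).trace

/-- Local conservation law for the energy, with the damping term `-(N / 2) N² e^{-Nτ} Tr (W²) / m`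
coming from the decay of the propagation speed. -/
theorem deriv_energyDensity_sub_deriv_energyFlux (hN : 1 ≤ N) (hvac : S.IsVacuum)
    (hareal : S.IsAreal) (ht₀ : t₀ = Real.exp (-τ₀)) {τ : ℝ} (hτ : τ ∈ Set.Ioi τ₀) (y : ℝ) :
    deriv (fun s => S.energyDensity s y) τ - deriv (S.energyFlux τ) y =
      -(N / 2) * (speedSq N τ * S.spatialDensity τ y) := by
  obtain ⟨hV, hW⟩ := S.hasMatDerivAt_velocity_and_spatialVelocity ht₀ hN hvac hareal hτ y
  have hWt := ((S.smooth_spatialVelocity ht₀).mono Ioi_prod_subset).hasMatDerivAt_fst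
    isOpen_Ioi hτ y
  have hVy := (S.smooth_velocity ht₀).hasMatDerivAt_snd hτ y
  have h1 := ((((hV.mul hV).trace.mul_const (S.density y)).fun_add
    ((hasDerivAt_speedSq (N := N) τ).fun_mul
      ((hWt.mul hWt).trace.div_const (S.density y)))).const_mul (1 / 2))
  have h2 := (hVy.mul hW).trace.const_mul (speedSq N τ)
  have e1 : deriv (fun s => S.energyDensity s y) τ = _ := h1.deriv
  have e2 : deriv (S.energyFlux τ) y = _ := h2.deriv
  rw [e1, e2]
  -- `Tr (W W_τ) = Tr (V_y W)` by the structure equation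
  have h3 : (matDeriv (fun s => S.spatialVelocity s y) τ * S.spatialVelocity τ y).trace =
      (matDeriv (S.velocity τ) y * S.spatialVelocity τ y).trace := by
    have h4 := congrArg (fun M => (M * S.spatialVelocity τ y).trace)
      (S.matDeriv_spatialVelocity ht₀ hτ y)
    simp only [add_mul, Matrix.trace_add] at h4
    rw [Matrix.trace_mul_comm (S.spatialVelocity τ y * S.velocity τ y), ← mul_assoc,
      mul_assoc (S.velocity τ y), Matrix.trace_mul_comm (S.velocity τ y)] at h4
    exact add_right_cancel h4
  have hm := (S.density_pos hN hareal (ht₀ ▸ Real.exp_pos _) y).ne'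
  have hc : speedSq N τ ≠ 0 := by
    have : (N : ℝ) ≠ 0 := by exact_mod_cast (by omega : N ≠ 0)
    unfold speedSq; positivity
  have hc' : (N : ℝ) ^ 2 * Real.exp (-τ) ^ N = speedSq N τ := rfl
  rw [hc']
  simp only [Matrix.trace_add, Matrix.mul_smul, Matrix.trace_smul, smul_eq_mul,
    spatialDensity]
  rw [Matrix.trace_mul_comm (S.acceleration τ y), Matrix.trace_mul_comm (S.spatialVelocity τ y)
    (matDeriv _ τ), h3]
  field_simp
  ring

theorem energyFlux_one (hareal : S.IsAreal) (ht₀ : t₀ = Real.exp (-τ₀)) {τ : ℝ}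
    (hτ : τ ∈ Set.Ioi τ₀) : S.energyFlux τ 1 = S.energyFlux τ 0 := by
  have h1 := S.velocity_add_one ht₀ hτ 0
  have h2 := S.spatialVelocity_add_one ht₀ (Set.Ioi_subset_Ici_self hτ) 0
  have h3 := S.density_periodic hareal (ht₀ ▸ Real.exp_pos _) 0
  rw [zero_add] at h1 h2 h3
  rw [energyFlux, h1, h2, h3, Matrix.mul_smul, Matrix.trace_smul, S.trace_mul_hol_conj,
    energyFlux, Matrix.mul_smul, Matrix.trace_smul]

theorem energyDensity_nonneg (hN : 1 ≤ N) (hareal : S.IsAreal) (ht₀ : t₀ = Real.exp (-τ₀))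
    {τ : ℝ} (hτ : τ ∈ Set.Ioi τ₀) (y : ℝ) : 0 ≤ S.energyDensity τ y := by
  have h1 := S.trace_velocity_sq_nonneg ht₀ hτ y
  have h2 := S.trace_spatialVelocity_sq_nonneg ht₀ (Set.Ioi_subset_Ici_self hτ) y
  have h3 := (S.density_pos hN hareal (ht₀ ▸ Real.exp_pos _) y).le
  have h4 := speedSq_nonneg (N := N) τ
  unfold energyDensity spatialDensity
  positivity

/-- The integral of `N² e^{-Nτ} Tr (W²) / m` over the circle, at time `τ`. -/
def dissipation (τ : ℝ) : ℝ := speedSq N τ * ∫ y in (0 : ℝ)..1, S.spatialDensity τ y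

theorem continuousOn_dissipation (hN : 1 ≤ N) (hareal : S.IsAreal) (ht₀ : t₀ = Real.exp (-τ₀)) :
    ContinuousOn S.dissipation (Set.Ici τ₀) :=
  contDiff_speedSq.continuous.continuousOn.mul
    (continuousOn_integral_of_continuousOn_strip
      (S.smooth_spatialDensity hN hareal ht₀).continuousOn)

theorem dissipation_nonneg (hN : 1 ≤ N) (hareal : S.IsAreal) (ht₀ : t₀ = Real.exp (-τ₀))
    {τ : ℝ} (hτ : τ ∈ Set.Ici τ₀) : 0 ≤ S.dissipation τ := by
  refine mul_nonneg (speedSq_nonneg τ) (intervalIntegral.integral_nonneg zero_le_one fun y _ => ?_)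
  exact div_nonneg (S.trace_spatialVelocity_sq_nonneg ht₀ hτ y)
    (S.density_pos hN hareal (ht₀ ▸ Real.exp_pos _) y).le

/-- The energy inequality on a time interval, from the divergence theorem on the rectangle
`[a, b] × [0, 1]`; the fluxes through the two sides `y = 0` and `y = 1` cancel. -/
theorem integral_dissipation_le (hN : 1 ≤ N) (hvac : S.IsVacuum)
    (hareal : S.IsAreal) (ht₀ : t₀ = Real.exp (-τ₀)) {a b : ℝ} (ha : τ₀ < a) (hab : a ≤ b) :
    N / 2 * ∫ τ in a..b, S.dissipation τ ≤ ∫ y in (0 : ℝ)..1, S.energyDensity a y := by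
  have hΩ : IsOpen (Set.Ioi τ₀ ×ˢ (Set.univ : Set ℝ)) := isOpen_Ioi.prod isOpen_univ
  have he := S.smooth_energyDensity hN hareal ht₀
  have hf := S.smooth_energyFlux hN hareal ht₀
  have hsub : Set.uIcc a b ×ˢ Set.uIcc (0 : ℝ) 1 ⊆ Set.Ioi τ₀ ×ˢ Set.univ := by
    rw [Set.uIcc_of_le hab]
    exact Set.prod_mono (fun s hs => ha.trans_le hs.1) (Set.subset_univ _)
  have hsub' : Set.Ioo (min a b) (max a b) ×ˢ Set.Ioo (min (0 : ℝ) 1) (max 0 1) ⊆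
      Set.Ioi τ₀ ×ˢ Set.univ :=
    (Set.prod_mono Set.Ioo_subset_Icc_self Set.Ioo_subset_Icc_self).trans hsub
  have hder : ∀ p ∈ Set.Ioi τ₀ ×ˢ (Set.univ : Set ℝ),
      fderiv ℝ (fun p : ℝ × ℝ => S.energyDensity p.1 p.2) p (1, 0)
        + (-fderiv ℝ (fun p : ℝ × ℝ => S.energyFlux p.1 p.2) p) (0, 1) =
      -(N / 2) * (speedSq N p.1 * S.spatialDensity p.1 p.2) := by
    intro p hp
    rw [← S.deriv_energyDensity_sub_deriv_energyFlux hN hvac hareal ht₀ hp.1 p.2,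
      (hasDerivAt_fst_of_contDiffOn isOpen_Ioi he hp.1 p.2).deriv,
      (hasDerivAt_snd_of_contDiffOn hf hp.1 p.2).deriv, fderivWithin_of_isOpen hΩ hp]
    simp [sub_eq_add_neg]
  have hcont : ContinuousOn (fun p : ℝ × ℝ => -((N : ℝ) / 2) *
      (speedSq N p.1 * S.spatialDensity p.1 p.2)) (Set.Ioi τ₀ ×ˢ Set.univ) :=
    continuousOn_const.mul ((contDiffOn_speedSq _).continuousOn.mul
      ((S.smooth_spatialDensity hN hareal ht₀).mono Ioi_prod_subset).continuousOn)
  have key := MeasureTheory.integral2_divergence_prod_of_hasFDerivAt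
    (fun p : ℝ × ℝ => S.energyDensity p.1 p.2) (fun p => -S.energyFlux p.1 p.2)
    (fun p => fderiv ℝ (fun p : ℝ × ℝ => S.energyDensity p.1 p.2) p)
    (fun p => -fderiv ℝ (fun p : ℝ × ℝ => S.energyFlux p.1 p.2) p) a 0 b 1
    (he.continuousOn.mono hsub) (hf.continuousOn.neg.mono hsub)
    (fun p hp => ((he.contDiffAt (hΩ.mem_nhds (hsub' hp))).differentiableAt
      (by simp)).hasFDerivAt)
    (fun p hp => ((hf.contDiffAt (hΩ.mem_nhds (hsub' hp))).differentiableAt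
      (by simp)).hasFDerivAt.neg)
    ((((hcont.mono hsub).congr fun p hp => hder p (hsub hp))).integrableOn_compact
      (isCompact_uIcc.prod isCompact_uIcc))
  have h1 : ∫ x in a..b, -S.energyFlux x 1 = ∫ x in a..b, -S.energyFlux x 0 := by
    refine intervalIntegral.integral_congr fun x hx => ?_
    rw [Set.uIcc_of_le hab] at hx
    simp only [S.energyFlux_one hareal ht₀ (ha.trans_le hx.1)]
  have h2 : (∫ x in a..b, ∫ y in (0 : ℝ)..1,
      (fderiv ℝ (fun p : ℝ × ℝ => S.energyDensity p.1 p.2) (x, y) (1, 0)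
        + (-fderiv ℝ (fun p : ℝ × ℝ => S.energyFlux p.1 p.2) (x, y)) (0, 1))) =
      ∫ x in a..b, -(N / 2) * S.dissipation x := by
    refine intervalIntegral.integral_congr fun x hx => ?_
    rw [Set.uIcc_of_le hab] at hx
    have h3 : ∀ y, fderiv ℝ (fun p : ℝ × ℝ => S.energyDensity p.1 p.2) (x, y) (1, 0)
        + (-fderiv ℝ (fun p : ℝ × ℝ => S.energyFlux p.1 p.2) (x, y)) (0, 1) = _ :=
      fun y => hder (x, y) ⟨ha.trans_le hx.1, trivial⟩
    simp only [h3, intervalIntegral.integral_const_mul, dissipation]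
  rw [h2, h1, intervalIntegral.integral_const_mul] at key
  have h4 : 0 ≤ ∫ y in (0 : ℝ)..1, S.energyDensity b y :=
    intervalIntegral.integral_nonneg zero_le_one fun y _ =>
      S.energyDensity_nonneg hN hareal ht₀ (ha.trans_le hab) y
  simp only at key
  linarith

/-- The dissipation is integrable up to `τ₀`: on `[τ₀, τ₀ + 1]` it is continuous, and beyond
it is controlled by the energy at time `τ₀ + 1`. -/
theorem lintegral_dissipation_lt_top (hN : 1 ≤ N) (hvac : S.IsVacuum)
    (hareal : S.IsAreal) (ht₀ : t₀ = Real.exp (-τ₀)) :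
    ∫⁻ τ in Set.Ici τ₀, ENNReal.ofReal (S.dissipation τ) < ⊤ := by
  have hcont := S.continuousOn_dissipation hN hareal ht₀
  have hN' : (0 : ℝ) < N := by exact_mod_cast hN
  have h1 : MeasureTheory.IntegrableOn S.dissipation (Set.Icc τ₀ (τ₀ + 1)) :=
    (hcont.mono Set.Icc_subset_Ici_self).integrableOn_Icc
  have h2 : MeasureTheory.IntegrableOn S.dissipation (Set.Ioi (τ₀ + 1)) := by
    refine MeasureTheory.integrableOn_Ioi_of_intervalIntegral_norm_bounded
      (2 / N * ∫ y in (0 : ℝ)..1, S.energyDensity (τ₀ + 1) y) (τ₀ + 1) (b := fun b : ℝ => b)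
      (l := Filter.atTop) (fun b => ?_) Filter.tendsto_id ?_
    · refine ((hcont.mono ?_).integrableOn_Icc (a := τ₀ + 1) (b := b)).mono_set
        Set.Ioc_subset_Icc_self
      exact fun s hs => (by linarith [hs.1] : τ₀ ≤ s)
    · filter_upwards [Filter.eventually_ge_atTop (τ₀ + 1)] with b hb
      have h3 := S.integral_dissipation_le hN hvac hareal ht₀ (lt_add_one τ₀) hb
      have h4 : ∫ x in (τ₀ + 1)..b, ‖S.dissipation x‖ = ∫ x in (τ₀ + 1)..b, S.dissipation x := by
        refine intervalIntegral.integral_congr fun x hx => ?_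
        rw [Set.uIcc_of_le hb] at hx
        exact Real.norm_of_nonneg (S.dissipation_nonneg hN hareal ht₀
          (by linarith [hx.1] : τ₀ ≤ x))
      rw [h4]
      calc ∫ x in (τ₀ + 1)..b, S.dissipation x
          = 2 / N * (N / 2 * ∫ x in (τ₀ + 1)..b, S.dissipation x) := by field_simp
        _ ≤ _ := by gcongr
  have h3 : MeasureTheory.IntegrableOn S.dissipation (Set.Ici τ₀) := by
    rw [← Set.Icc_union_Ioi_eq_Ici (show τ₀ ≤ τ₀ + 1 by linarith)]
    exact h1.union h2
  exact h3.lintegral_lt_top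

end GowdySpacetime

/-! ### Families of self-adjoint sections -/

theorem MatContDiffOn.contDiff_slice {N : ℕ} {A : ℝ → ℝ → Matrix (Fin N) (Fin N) ℝ} {T : Set ℝ}
    (hA : MatContDiffOn A (T ×ˢ Set.univ)) {τ : ℝ} (hτ : τ ∈ T) (i j : Fin N) :
    ContDiff ℝ ∞ (fun y => A τ y i j) := by
  rw [← contDiffOn_univ]
  exact (hA i j).comp (f := fun y : ℝ => (τ, y)) (contDiff_const.prodMk contDiff_id).contDiffOn
    (fun y _ => ⟨hτ, trivial⟩)

namespace GowdySpacetime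

variable {N : ℕ} {t₀ : ℝ} (S : GowdySpacetime N t₀) {τ₀ : ℝ}

theorem Dy_exp_neg (τ : ℝ) (ζ : ℝ → Matrix (Fin N) (Fin N) ℝ) (y : ℝ) :
    S.Dy (Real.exp (-τ)) ζ y = matDeriv ζ y +
      (1 / 2 : ℝ) • (S.spatialVelocity τ y * ζ y - ζ y * S.spatialVelocity τ y) := rfl

theorem smooth_Dy (ht₀ : t₀ = Real.exp (-τ₀)) {Z : ℝ → ℝ → Matrix (Fin N) (Fin N) ℝ}
    (hZ : MatContDiffOn Z (Set.Ioi τ₀ ×ˢ Set.univ)) :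
    MatContDiffOn (fun τ y => S.Dy (Real.exp (-τ)) (Z τ) y) (Set.Ioi τ₀ ×ˢ Set.univ) := by
  have hW := (S.smooth_spatialVelocity ht₀).mono Ioi_prod_subset
  exact (hZ.matDeriv_snd isOpen_Ioi.uniqueDiffOn).add
    (MatContDiffOn.smul (c := fun _ _ => 1 / 2) contDiffOn_const ((hW.mul hZ).sub (hZ.mul hW)))

/-- The family of sections `τ' ↦ G(τ')⁻¹ G(τ) ζ`, which has the same associated bilinear form
at all times, and so consists of self-adjoint sections if `ζ` is self-adjoint at time `τ`. -/
def transport (τ : ℝ) (ζ : ℝ → Matrix (Fin N) (Fin N) ℝ) (τ' y : ℝ) : Matrix (Fin N) (Fin N) ℝ :=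
  (S.G (Real.exp (-τ')) y)⁻¹ * (S.G (Real.exp (-τ)) y * ζ y)

theorem transport_self (ht₀ : t₀ = Real.exp (-τ₀)) {τ : ℝ} (hτ : τ ∈ Set.Ioi τ₀)
    (ζ : ℝ → Matrix (Fin N) (Fin N) ℝ) : S.transport τ ζ τ = ζ := by
  funext y
  exact Matrix.nonsing_inv_mul_cancel_left _ _
    (S.isUnit_det_G (exp_neg_mem_Ioc ht₀ (Set.Ioi_subset_Ici_self hτ)) y)

theorem transport_ne_zero (ht₀ : t₀ = Real.exp (-τ₀)) {τ τ' : ℝ} (hτ : τ ∈ Set.Ioi τ₀)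
    (hτ' : τ' ∈ Set.Ioi τ₀) {ζ : ℝ → Matrix (Fin N) (Fin N) ℝ} (hζ : ζ ≠ 0) :
    S.transport τ ζ τ' ≠ 0 := by
  intro h
  refine hζ ?_
  funext y
  have h1 : S.G (Real.exp (-τ')) y * S.transport τ ζ τ' y = 0 := by rw [h]; simp
  rw [transport, Matrix.mul_nonsing_inv_cancel_left _ _
    (S.isUnit_det_G (exp_neg_mem_Ioc ht₀ (Set.Ioi_subset_Ici_self hτ')) y)] at h1
  rw [← Matrix.nonsing_inv_mul_cancel_left _ (ζ y)
    (S.isUnit_det_G (exp_neg_mem_Ioc ht₀ (Set.Ioi_subset_Ici_self hτ)) y), h1]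
  simp

theorem smooth_transport (ht₀ : t₀ = Real.exp (-τ₀)) {τ : ℝ} (hτ : τ ∈ Set.Ioi τ₀)
    {ζ : ℝ → Matrix (Fin N) (Fin N) ℝ} (hζ : S.IsSelfAdjointSection (Real.exp (-τ)) ζ) :
    MatContDiffOn (S.transport τ ζ) (Set.Ioi τ₀ ×ˢ Set.univ) := by
  have h1 : MatContDiffOn (fun (_ : ℝ) y => S.G (Real.exp (-τ)) y) (Set.Ioi τ₀ ×ˢ Set.univ) :=
    fun i j => (((S.smooth_G_exp ht₀).contDiff_slice (Set.Ioi_subset_Ici_self hτ) i j).comp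
      contDiff_snd).contDiffOn
  have h2 : MatContDiffOn (fun (_ : ℝ) y => ζ y) (Set.Ioi τ₀ ×ˢ Set.univ) :=
    fun i j => ((hζ.1 i j).comp contDiff_snd).contDiffOn
  exact ((S.smooth_G_exp_inv ht₀).mono Ioi_prod_subset).mul (h1.mul h2)

theorem IsSelfAdjointSection.transpose_mul {S : GowdySpacetime N t₀} {t : ℝ}
    (ht : t ∈ Set.Ioc 0 t₀) {ζ : ℝ → Matrix (Fin N) (Fin N) ℝ} (hζ : S.IsSelfAdjointSection t ζ)
    (y : ℝ) : (S.G t y * ζ y).transpose = S.G t y * ζ y := by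
  rw [Matrix.transpose_mul, hζ.2.2 y, S.transpose_G ht,
    Matrix.nonsing_inv_mul_cancel_right _ _ (S.isUnit_det_G ht y)]

theorem isSelfAdjointSection_transport (ht₀ : t₀ = Real.exp (-τ₀)) {τ τ' : ℝ}
    (hτ : τ ∈ Set.Ioi τ₀) (hτ' : τ' ∈ Set.Ioi τ₀) {ζ : ℝ → Matrix (Fin N) (Fin N) ℝ}
    (hζ : S.IsSelfAdjointSection (Real.exp (-τ)) ζ) :
    S.IsSelfAdjointSection (Real.exp (-τ')) (S.transport τ ζ τ') := by
  have ht := exp_neg_mem_Ioc ht₀ (Set.Ioi_subset_Ici_self hτ)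
  have ht' := exp_neg_mem_Ioc ht₀ (Set.Ioi_subset_Ici_self hτ')
  refine ⟨(S.smooth_transport ht₀ hτ hζ).contDiff_slice hτ', fun y => ?_, fun y => ?_⟩
  · rw [transport, hζ.2.1, S.equivariant_G _ ht]
    have h : (S.hol : Matrix (Fin N) (Fin N) ℝ).transpose * S.G (Real.exp (-τ)) y *
        (S.hol : Matrix (Fin N) (Fin N) ℝ) *
        (((S.hol⁻¹ : Matrix.SpecialLinearGroup (Fin N) ℝ) : Matrix (Fin N) (Fin N) ℝ) * ζ y *
          (S.hol : Matrix (Fin N) (Fin N) ℝ)) =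
        (S.hol : Matrix (Fin N) (Fin N) ℝ).transpose * (S.G (Real.exp (-τ)) y * ζ y) *
          (S.hol : Matrix (Fin N) (Fin N) ℝ) := by
      simp only [mul_assoc]
      rw [← mul_assoc (S.hol : Matrix (Fin N) (Fin N) ℝ), S.hol_mul_inv, one_mul]
    rw [h, S.inv_G_add_one_mul ht', transport]
  · rw [transport, Matrix.mul_nonsing_inv_cancel_left _ _ (S.isUnit_det_G ht' y),
      Matrix.transpose_mul, hζ.transpose_mul ht, Matrix.transpose_nonsing_inv,
      S.transpose_G ht']

theorem IsSelfAdjointSection.hasMatDerivAt {S : GowdySpacetime N t₀} {t : ℝ}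
    {ζ : ℝ → Matrix (Fin N) (Fin N) ℝ} (hζ : S.IsSelfAdjointSection t ζ) (y : ℝ) :
    HasMatDerivAt ζ (matDeriv ζ y) y := fun i j =>
  ((hζ.1 i j).differentiable (by simp) y).hasDerivAt

/-- The derivative `D_y` preserves self-adjointness. -/
theorem IsSelfAdjointSection.transpose_mul_Dy {S : GowdySpacetime N t₀}
    (ht₀ : t₀ = Real.exp (-τ₀)) {τ : ℝ} (hτ : τ ∈ Set.Ioi τ₀)
    {ζ : ℝ → Matrix (Fin N) (Fin N) ℝ} (hζ : S.IsSelfAdjointSection (Real.exp (-τ)) ζ) (y : ℝ) :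
    (S.G (Real.exp (-τ)) y * S.Dy (Real.exp (-τ)) ζ y).transpose =
      S.G (Real.exp (-τ)) y * S.Dy (Real.exp (-τ)) ζ y := by
  have ht := exp_neg_mem_Ioc ht₀ (Set.Ioi_subset_Ici_self hτ)
  have hG := S.isUnit_det_G ht y
  have h1 := (S.hasMatDerivAt_G_snd ht y).mul (hζ.hasMatDerivAt y)
  have h2 := h1.transpose.congr_of_eventuallyEq
    (B := fun z => S.G (Real.exp (-τ)) z * ζ z)
    (Filter.Eventually.of_forall fun z => (hζ.transpose_mul ht z).symm)
  have h3 := h2.matDeriv_eq.symm.trans h1.matDeriv_eq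
  have h4 := hζ.transpose_mul ht y
  simp only [Matrix.transpose_add, Matrix.transpose_mul, S.transpose_G ht,
    S.transpose_dyG ht] at h3 h4
  have h5 : (ζ y).transpose * S.dyG (Real.exp (-τ)) y =
      S.G (Real.exp (-τ)) y * (ζ y * S.spatialVelocity τ y) := by
    rw [hζ.2.2 y, spatialVelocity]; simp only [mul_assoc]
  have h6 : S.G (Real.exp (-τ)) y * (S.spatialVelocity τ y * ζ y) =
      S.dyG (Real.exp (-τ)) y * ζ y := by
    rw [spatialVelocity, ← mul_assoc, Matrix.mul_nonsing_inv_cancel_left _ _ hG]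
  have h7 : (S.G (Real.exp (-τ)) y * (ζ y * S.spatialVelocity τ y)).transpose =
      S.dyG (Real.exp (-τ)) y * ζ y := by
    rw [← h5, Matrix.transpose_mul, Matrix.transpose_transpose, S.transpose_dyG ht]
  have h8 : (S.dyG (Real.exp (-τ)) y * ζ y).transpose =
      S.G (Real.exp (-τ)) y * (ζ y * S.spatialVelocity τ y) := by
    rw [← h7, Matrix.transpose_transpose]
  have h9 : (S.G (Real.exp (-τ)) y * matDeriv ζ y).transpose =
      (matDeriv ζ y).transpose * S.G (Real.exp (-τ)) y := by
    rw [Matrix.transpose_mul, S.transpose_G ht]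
  rw [Dy_exp_neg, mul_add, Matrix.mul_smul, mul_sub, h6, Matrix.transpose_add,
    Matrix.transpose_smul, Matrix.transpose_sub, h7, h8, h9]
  rw [h5] at h3
  linear_combination (norm := module) h3

/-! ### The dual estimate -/

/-- Weak form of the evolution equation, tested against a self-adjoint section. -/
theorem integral_trace_acceleration_mul (hN : 1 ≤ N) (hvac : S.IsVacuum)
    (hareal : S.IsAreal) (ht₀ : t₀ = Real.exp (-τ₀)) {τ : ℝ} (hτ : τ ∈ Set.Ioi τ₀)
    {ζ : ℝ → Matrix (Fin N) (Fin N) ℝ} (hζ : S.IsSelfAdjointSection (Real.exp (-τ)) ζ) :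
    ∫ y in (0 : ℝ)..1, (S.acceleration τ y * ζ y).trace * S.mu (Real.exp (-τ)) y =
      -(speedSq N τ * ∫ y in (0 : ℝ)..1,
        (S.spatialVelocity τ y * S.Dy (Real.exp (-τ)) ζ y).trace / S.density y) := by
  have hpos := S.density_pos hN hareal (ht₀ ▸ Real.exp_pos _)
  have hc : speedSq N τ ≠ 0 := by
    have : (N : ℝ) ≠ 0 := by exact_mod_cast (by omega : N ≠ 0)
    unfold speedSq; positivity
  have hZ := S.smooth_transport ht₀ hτ hζ
  have hD := S.smooth_Dy ht₀ hZ
  have hself := S.transport_self ht₀ hτ ζ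
  have hcont1 : Continuous fun y => (S.acceleration τ y * ζ y).trace * S.density y := by
    have := continuous_slice_of_continuousOn_strip
      (f := fun τ' y => (S.acceleration τ' y * S.transport τ ζ τ' y).trace * S.density y)
      (((S.smooth_acceleration ht₀).mul hZ).trace.mul
        (S.contDiffOn_density hareal ht₀ _)).continuousOn hτ
    simpa only [hself] using this
  have hcont2 : Continuous fun y =>
      (S.spatialVelocity τ y * S.Dy (Real.exp (-τ)) ζ y).trace / S.density y := by
    have := continuous_slice_of_continuousOn_strip
      (f := fun τ' y => (S.spatialVelocity τ' y *
        S.Dy (Real.exp (-τ')) (S.transport τ ζ τ') y).trace / S.density y)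
      ((((S.smooth_spatialVelocity ht₀).mono Ioi_prod_subset).mul hD).trace.div
        (S.contDiffOn_density hareal ht₀ _) fun p _ => (hpos p.2).ne').continuousOn hτ
    simpa only [hself] using this
  have hder : ∀ y, HasDerivAt
      (fun z => (((S.density z)⁻¹ • S.spatialVelocity τ z) * ζ z).trace)
      ((speedSq N τ)⁻¹ * ((S.acceleration τ y * ζ y).trace * S.density y) +
        (S.spatialVelocity τ y * S.Dy (Real.exp (-τ)) ζ y).trace / S.density y) y := by
    intro y
    obtain ⟨-, hW⟩ := S.hasMatDerivAt_velocity_and_spatialVelocity ht₀ hN hvac hareal hτ y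
    refine (hW.mul (hζ.hasMatDerivAt y)).trace.congr_deriv ?_
    -- the commutator in `D_y ζ` does not contribute, being trace orthogonal to `W`
    have h1 : (S.spatialVelocity τ y * S.Dy (Real.exp (-τ)) ζ y).trace =
        (S.spatialVelocity τ y * matDeriv ζ y).trace := by
      rw [Dy_exp_neg, mul_add, Matrix.mul_smul, mul_sub, Matrix.trace_add, Matrix.trace_smul,
        Matrix.trace_sub, ← mul_assoc (S.spatialVelocity τ y) (ζ y),
        Matrix.trace_mul_comm (S.spatialVelocity τ y * ζ y), sub_self, smul_zero, add_zero]
    have h2 : (N : ℝ) ^ 2 * Real.exp (-τ) ^ N = speedSq N τ := rfl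
    rw [h1, h2, Matrix.trace_add, Matrix.smul_mul, Matrix.smul_mul, Matrix.trace_smul,
      Matrix.trace_smul, smul_eq_mul, smul_eq_mul]
    ring
  have hint := intervalIntegral.integral_eq_sub_of_hasDerivAt (a := 0) (b := 1)
    (fun y _ => hder y) (((continuous_const.fun_mul hcont1).add hcont2).intervalIntegrable _ _)
  have hper : (((S.density 1)⁻¹ • S.spatialVelocity τ 1) * ζ 1).trace =
      (((S.density 0)⁻¹ • S.spatialVelocity τ 0) * ζ 0).trace := by
    have h1 := S.spatialVelocity_add_one ht₀ (Set.Ioi_subset_Ici_self hτ) 0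
    have h2 := hζ.2.1 0
    have h3 := S.density_periodic hareal (ht₀ ▸ Real.exp_pos _) 0
    rw [zero_add] at h1 h2 h3
    rw [h1, h2, h3, Matrix.smul_mul, Matrix.trace_smul, S.trace_mul_hol_conj, Matrix.smul_mul,
      Matrix.trace_smul]
  rw [hper, sub_self, intervalIntegral.integral_add
    ((continuous_const.fun_mul hcont1).intervalIntegrable _ _) (hcont2.intervalIntegrable _ _),
    intervalIntegral.integral_const_mul] at hint
  simp only [S.mu_eq_density hvac hareal (exp_neg_mem_Ioo ht₀ hτ)]
  field_simp at hint
  linarith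

/-- The Cauchy-Schwarz inequality for the trace form on self-adjoint endomorphism fields. -/
theorem sq_integral_trace_mul_le {m : ℝ → ℝ} {G A B : ℝ → Matrix (Fin N) (Fin N) ℝ}
    (hm : ∀ y, 0 < m y) (hG : ∀ y, (G y).PosDef)
    (hA : ∀ y, (G y * A y).transpose = G y * A y) (hB : ∀ y, (G y * B y).transpose = G y * B y)
    (hAA : Continuous fun y => (A y * A y).trace / m y)
    (hAB : Continuous fun y => (A y * B y).trace / m y)
    (hBB : Continuous fun y => (B y * B y).trace / m y) :
    (∫ y in (0 : ℝ)..1, (A y * B y).trace / m y) ^ 2 ≤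
      (∫ y in (0 : ℝ)..1, (A y * A y).trace / m y) *
        ∫ y in (0 : ℝ)..1, (B y * B y).trace / m y := by
  have key : ∀ s : ℝ, 0 ≤ (∫ y in (0 : ℝ)..1, (A y * A y).trace / m y) * (s * s) +
      (2 * ∫ y in (0 : ℝ)..1, (A y * B y).trace / m y) * s +
      ∫ y in (0 : ℝ)..1, (B y * B y).trace / m y := by
    intro s
    have h1 : ∀ y, 0 ≤ ((s • A y + B y) * (s • A y + B y)).trace / m y := fun y =>
      div_nonneg (trace_mul_self_nonneg_of_selfAdjoint (hG y) (by
        rw [mul_add, Matrix.mul_smul, Matrix.transpose_add, Matrix.transpose_smul, hA, hB]))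
        (hm y).le
    have h2 : ∀ y, ((s • A y + B y) * (s • A y + B y)).trace / m y =
        s * s * ((A y * A y).trace / m y) + 2 * s * ((A y * B y).trace / m y) +
          (B y * B y).trace / m y := by
      intro y
      simp only [add_mul, mul_add, Matrix.smul_mul, Matrix.mul_smul, Matrix.trace_add,
        Matrix.trace_smul, smul_eq_mul, Matrix.trace_mul_comm (B y) (A y)]
      ring
    have h3 : 0 ≤ ∫ y in (0 : ℝ)..1, ((s • A y + B y) * (s • A y + B y)).trace / m y :=
      intervalIntegral.integral_nonneg zero_le_one fun y _ => h1 y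
    simp only [h2] at h3
    rw [intervalIntegral.integral_add
      (((continuous_const.fun_mul hAA).fun_add
        (continuous_const.fun_mul hAB)).intervalIntegrable _ _)
      (hBB.intervalIntegrable _ _), intervalIntegral.integral_add
      ((continuous_const.fun_mul hAA).intervalIntegrable _ _)
      ((continuous_const.fun_mul hAB).intervalIntegrable _ _),
      intervalIntegral.integral_const_mul, intervalIntegral.integral_const_mul] at h3
    linarith
  have h := discrim_le_zero key
  rw [discrim] at h
  linarith

theorem hNegOneNorm_acceleration_le (hN : 1 ≤ N) (hvac : S.IsVacuum)
    (hareal : S.IsAreal) (ht₀ : t₀ = Real.exp (-τ₀)) {τ : ℝ} (hτ : τ ∈ Set.Ioi τ₀) :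
    S.hNegOneNorm (Real.exp (-τ)) (S.acceleration τ) ≤
      ENNReal.ofReal (speedSq N τ * √(∫ y in (0 : ℝ)..1, S.spatialDensity τ y)) := by
  refine iSup_le fun ζ => iSup_le fun hζ => iSup_le fun _ => ENNReal.ofReal_le_ofReal ?_
  have ht := exp_neg_mem_Ioc ht₀ (Set.Ioi_subset_Ici_self hτ)
  have hpos := S.density_pos hN hareal (ht₀ ▸ Real.exp_pos _)
  have hZ := S.smooth_transport ht₀ hτ hζ
  have hD := S.smooth_Dy ht₀ hZ
  have hself := S.transport_self ht₀ hτ ζ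
  have hW := (S.smooth_spatialVelocity ht₀).mono Ioi_prod_subset
  have hdens := S.contDiffOn_density hareal ht₀ (Set.Ioi τ₀ ×ˢ Set.univ)
  have hdens0 : ∀ p ∈ Set.Ioi τ₀ ×ˢ (Set.univ : Set ℝ), S.density p.2 ≠ 0 :=
    fun p _ => (hpos p.2).ne'
  have hWW : Continuous fun y =>
      (S.spatialVelocity τ y * S.spatialVelocity τ y).trace / S.density y :=
    continuous_slice_of_continuousOn_strip
      (f := fun τ' y => (S.spatialVelocity τ' y * S.spatialVelocity τ' y).trace / S.density y)
      ((hW.mul hW).trace.div hdens hdens0).continuousOn hτ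
  have hWD : Continuous fun y =>
      (S.spatialVelocity τ y * S.Dy (Real.exp (-τ)) ζ y).trace / S.density y := by
    have := continuous_slice_of_continuousOn_strip
      (f := fun τ' y => (S.spatialVelocity τ' y *
        S.Dy (Real.exp (-τ')) (S.transport τ ζ τ') y).trace / S.density y)
      ((hW.mul hD).trace.div hdens hdens0).continuousOn hτ
    simpa only [hself] using this
  have hDD : Continuous fun y =>
      (S.Dy (Real.exp (-τ)) ζ y * S.Dy (Real.exp (-τ)) ζ y).trace / S.density y := by
    have := continuous_slice_of_continuousOn_strip
      (f := fun τ' y => (S.Dy (Real.exp (-τ')) (S.transport τ ζ τ') y *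
        S.Dy (Real.exp (-τ')) (S.transport τ ζ τ') y).trace / S.density y)
      ((hD.mul hD).trace.div hdens hdens0).continuousOn hτ
    simpa only [hself] using this
  have hζζ : Continuous fun y => (ζ y * ζ y).trace * S.density y := by
    have := continuous_slice_of_continuousOn_strip
      (f := fun τ' y => (S.transport τ ζ τ' y * S.transport τ ζ τ' y).trace * S.density y)
      ((hZ.mul hZ).trace.mul hdens).continuousOn hτ
    simpa only [hself] using this
  have hCS := sq_integral_trace_mul_le hpos (fun y => S.posDef_G _ ht y)
    (S.transpose_G_mul_spatialVelocity ht₀ (Set.Ioi_subset_Ici_self hτ))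
    (hζ.transpose_mul_Dy ht₀ hτ) hWW hWD hDD
  have hsob : ∫ y in (0 : ℝ)..1,
      (S.Dy (Real.exp (-τ)) ζ y * S.Dy (Real.exp (-τ)) ζ y).trace / S.density y ≤
      S.sobolevSq (Real.exp (-τ)) ζ := by
    simp only [sobolevSq, S.mu_eq_density hvac hareal (exp_neg_mem_Ioo ht₀ hτ)]
    rw [intervalIntegral.integral_add (hζζ.intervalIntegrable _ _) (hDD.intervalIntegrable _ _)]
    have : 0 ≤ ∫ y in (0 : ℝ)..1, (ζ y * ζ y).trace * S.density y :=
      intervalIntegral.integral_nonneg zero_le_one fun y _ =>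
        mul_nonneg (trace_mul_self_nonneg_of_selfAdjoint (S.posDef_G _ ht y)
          (hζ.transpose_mul ht y)) (hpos y).le
    linarith
  have hA : 0 ≤ ∫ y in (0 : ℝ)..1, S.spatialDensity τ y :=
    intervalIntegral.integral_nonneg zero_le_one fun y _ => div_nonneg
      (S.trace_spatialVelocity_sq_nonneg ht₀ (Set.Ioi_subset_Ici_self hτ) y) (hpos y).le
  have hc := speedSq_nonneg (N := N) τ
  refine div_le_of_le_mul₀ (Real.sqrt_nonneg _) (by positivity) ?_
  rw [S.integral_trace_acceleration_mul hN hvac hareal ht₀ hτ hζ, ← mul_neg, mul_assoc,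
    ← Real.sqrt_mul hA]
  refine mul_le_mul_of_nonneg_left ((neg_le_abs _).trans (Real.abs_le_sqrt ?_)) hc
  exact hCS.trans (mul_le_mul_of_nonneg_left hsob hA)

/-- The integrand of the theorem is at most `N²` times the dissipation, since
`e^{Nτ} (N² e^{-Nτ})² = N² (N² e^{-Nτ})`. -/
theorem exp_mul_hNegOneNorm_sq_le (hN : 1 ≤ N) (hvac : S.IsVacuum)
    (hareal : S.IsAreal) (ht₀ : t₀ = Real.exp (-τ₀)) {τ : ℝ} (hτ : τ ∈ Set.Ioi τ₀) :
    ENNReal.ofReal (Real.exp ((N : ℝ) * τ)) *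
        S.hNegOneNorm (Real.exp (-τ)) (S.acceleration τ) ^ 2 ≤
      ENNReal.ofReal ((N : ℝ) ^ 2) * ENNReal.ofReal (S.dissipation τ) := by
  have hA : 0 ≤ ∫ y in (0 : ℝ)..1, S.spatialDensity τ y :=
    intervalIntegral.integral_nonneg zero_le_one fun y _ => div_nonneg
      (S.trace_spatialVelocity_sq_nonneg ht₀ (Set.Ioi_subset_Ici_self hτ) y)
      (S.density_pos hN hareal (ht₀ ▸ Real.exp_pos _) y).le
  have hc := speedSq_nonneg (N := N) τ
  have he : Real.exp (N * τ) * Real.exp (-τ) ^ N = 1 := by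
    rw [← Real.exp_nat_mul, ← Real.exp_add]
    simp
  calc _ ≤ ENNReal.ofReal (Real.exp ((N : ℝ) * τ)) *
        ENNReal.ofReal (speedSq N τ * √(∫ y in (0 : ℝ)..1, S.spatialDensity τ y)) ^ 2 := by
        gcongr
        exact S.hNegOneNorm_acceleration_le hN hvac hareal ht₀ hτ
    _ = _ := by
        rw [← ENNReal.ofReal_pow (by positivity), ← ENNReal.ofReal_mul (by positivity),
          ← ENNReal.ofReal_mul (by positivity), mul_pow, Real.sq_sqrt hA, dissipation]
        congr 1
        have h : Real.exp (N * τ) * speedSq N τ = N ^ 2 := by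
          unfold speedSq
          linear_combination (N : ℝ) ^ 2 * he
        linear_combination speedSq N τ * (∫ y in (0 : ℝ)..1, S.spatialDensity τ y) * h

/-! ### Measurability of the dual norm -/

/-- The dual norm of the acceleration is lower semicontinuous in time: a test section at time
`τ` extends by `transport` to test sections at nearby times, with continuous quotient. -/
theorem eventually_lt_hNegOneNorm (hN : 1 ≤ N) (hvac : S.IsVacuum)
    (hareal : S.IsAreal) (ht₀ : t₀ = Real.exp (-τ₀)) {τ : ℝ} (hτ : τ ∈ Set.Ioi τ₀) {b : ENNReal}
    (hb : b < S.hNegOneNorm (Real.exp (-τ)) (S.acceleration τ)) :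
    ∀ᶠ s in nhds τ, b < S.hNegOneNorm (Real.exp (-s)) (S.acceleration s) := by
  simp only [hNegOneNorm, lt_iSup_iff] at hb
  obtain ⟨ζ, hζ, hζ0, hb⟩ := hb
  have hpos := S.density_pos hN hareal (ht₀ ▸ Real.exp_pos _)
  have hZ := S.smooth_transport ht₀ hτ hζ
  have hD := S.smooth_Dy ht₀ hZ
  have hdens := S.contDiffOn_density hareal ht₀ (Set.Ioi τ₀ ×ˢ Set.univ)
  have hdens0 : ∀ p ∈ Set.Ioi τ₀ ×ˢ (Set.univ : Set ℝ), S.density p.2 ≠ 0 :=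
    fun p _ => (hpos p.2).ne'
  have hmu : ∀ s ∈ Set.Ioi τ₀, ∀ y, S.mu (Real.exp (-s)) y = S.density y := fun s hs =>
    S.mu_eq_density hvac hareal (exp_neg_mem_Ioo ht₀ hs)
  have hnum : ContinuousAt (fun s => ∫ y in (0 : ℝ)..1,
      (S.acceleration s y * S.transport τ ζ s y).trace * S.mu (Real.exp (-s)) y) τ := by
    refine ((continuousOn_integral_of_continuousOn_strip
      (f := fun s y => (S.acceleration s y * S.transport τ ζ s y).trace * S.density y)
      (((S.smooth_acceleration ht₀).mul hZ).trace.mul hdens).continuousOn).congr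
      fun s hs => ?_).continuousAt (isOpen_Ioi.mem_nhds hτ)
    simp only [hmu s hs]
  have hden : ContinuousAt (fun s => S.sobolevSq (Real.exp (-s)) (S.transport τ ζ s)) τ := by
    refine ((continuousOn_integral_of_continuousOn_strip
      (f := fun s y => (S.transport τ ζ s y * S.transport τ ζ s y).trace * S.density y +
        (S.Dy (Real.exp (-s)) (S.transport τ ζ s) y *
          S.Dy (Real.exp (-s)) (S.transport τ ζ s) y).trace / S.density y)
      (((hZ.mul hZ).trace.mul hdens).add
        ((hD.mul hD).trace.div hdens hdens0)).continuousOn).congr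
      fun s hs => ?_).continuousAt (isOpen_Ioi.mem_nhds hτ)
    simp only [sobolevSq, hmu s hs]
  have hself := S.transport_self ht₀ hτ ζ
  -- where the denominator vanishes, the quotient is zero and does not exceed `b`
  have hden0 : √(S.sobolevSq (Real.exp (-τ)) (S.transport τ ζ τ)) ≠ 0 := by
    intro h
    rw [hself] at h
    rw [h, div_zero, ENNReal.ofReal_zero] at hb
    exact not_lt_bot hb
  have hquot := ENNReal.continuous_ofReal.continuousAt.comp (hnum.div hden.sqrt hden0)
  have hlt := hquot.eventually (lt_mem_nhds (a := b)
    (by simpa only [Function.comp, Pi.div_apply, hself] using hb))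
  filter_upwards [hlt, isOpen_Ioi.mem_nhds hτ] with s hs hs'
  refine lt_of_lt_of_le hs ?_
  exact le_iSup_of_le (S.transport τ ζ s)
    (le_iSup_of_le (S.isSelfAdjointSection_transport ht₀ hτ hs' hζ)
      (le_iSup_of_le (S.transport_ne_zero ht₀ hτ hs' hζ0) le_rfl))

theorem aemeasurable_hNegOneNorm (hN : 1 ≤ N) (hvac : S.IsVacuum)
    (hareal : S.IsAreal) (ht₀ : t₀ = Real.exp (-τ₀)) :
    AEMeasurable (fun τ : ℝ => S.hNegOneNorm (Real.exp (-τ)) (S.acceleration τ))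
      (MeasureTheory.volume.restrict (Set.Ioi τ₀)) := by
  refine aemeasurable_restrict_of_measurable_subtype measurableSet_Ioi
    (LowerSemicontinuous.measurable fun τ b hb => ?_)
  exact continuous_subtype_val.continuousAt.eventually
    (S.eventually_lt_hNegOneNorm hN hvac hareal ht₀ τ.2 hb)

end GowdySpacetime

end

theorem theorem0p3 (N : ℕ) (hN : 1 ≤ N) (t₀ τ₀ : ℝ) (ht₀ : t₀ = Real.exp (-τ₀))
    (S : GowdySpacetime N t₀) (hvac : S.IsVacuum) (hareal : S.IsAreal) :
    AEMeasurable
        (fun τ : ℝ => S.hNegOneNorm (Real.exp (-τ)) (S.acceleration τ))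
        (MeasureTheory.volume.restrict (Set.Ici τ₀)) ∧
      ∫⁻ τ in Set.Ici τ₀, ENNReal.ofReal (Real.exp ((N : ℝ) * τ)) *
        S.hNegOneNorm (Real.exp (-τ)) (S.acceleration τ) ^ 2 < ⊤ := by
  -- The two-sided time derivatives carry no information at `τ = τ₀`, where `t = t₀` is the
  -- boundary of the domain; this single time is negligible.
  have hae : MeasureTheory.volume.restrict (Set.Ici τ₀) =
      MeasureTheory.volume.restrict (Set.Ioi τ₀) :=
    (MeasureTheory.Measure.restrict_congr_set MeasureTheory.Ioi_ae_eq_Ici).symm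
  have hfin := S.lintegral_dissipation_lt_top hN hvac hareal ht₀
  rw [hae] at hfin ⊢
  refine ⟨S.aemeasurable_hNegOneNorm hN hvac hareal ht₀, ?_⟩
  calc _ ≤ ∫⁻ τ in Set.Ioi τ₀, ENNReal.ofReal ((N : ℝ) ^ 2) * ENNReal.ofReal (S.dissipation τ) :=
        MeasureTheory.setLIntegral_mono' measurableSet_Ioi fun τ hτ =>
          S.exp_mul_hNegOneNorm_sq_le hN hvac hareal ht₀ hτ
    _ = ENNReal.ofReal ((N : ℝ) ^ 2) *
        ∫⁻ τ in Set.Ioi τ₀, ENNReal.ofReal (S.dissipation τ) :=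
        MeasureTheory.lintegral_const_mul' _ _ ENNReal.ofReal_ne_top
    _ < ⊤ := ENNReal.mul_lt_top ENNReal.ofReal_lt_top hfin
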